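/- Write $|x|$ for the Euclidean norm and $|x|_+=\max(|x|,1)$ for $x\in\mathbb Z^5$. There is an absolute constant $C>0$ such that the following holds. Let $S=(S_i)_{i\ge 0}$ and $\tilde S=(\tilde S_j)_{j\ge 0}$ be independent simple random walks on $\mathbb{Z}^5$ starting from the origin. Then for all integers $n\ge 2$ and $m\ge 1$, the random variables below are integrable and $$\mathbb{E}\left[\Big(\sum_{1\le i,j_1,j_2\le n}|S_i-\tilde S_{j_1}|_+^{-3}\,|S_i-\tilde S_{j_2}|_+^{-3}\Big)^m\right]=\mathbb{E}\left[\sum_{1\le i_1,\dots,i_m\le n}\ \sum_{1\le j_1,\dots,j_{2m}\le n}\ \prod_{k=1}^m|S_{i_k}-\tilde S_{j_{2k-1}}|_+^{-3}\,|S_{i_k}-\tilde S_{j_{2k}}|_+^{-3}\right]\le C^m(m!)^3(\log n)^{3m}.$$ -/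

import Mathlib

open MeasureTheory ProbabilityTheory
open scoped Nat

/-- The `2d` nearest-neighbour steps `± e_k` of the lattice `ℤ^d`. -/
def unitSteps (d : ℕ) : Set (Fin d → ℤ) :=
  {e | ∃ k : Fin d, e = Pi.single k 1 ∨ e = -Pi.single k 1}

/-- `S` is, under `P`, a simple random walk on `ℤ^d` starting from the origin:
`S 0 = 0` almost surely, and the increments are independent and uniformly distributed
on the `2d` unit steps. -/
structure IsSimpleRandomWalk {Ω : Type*} [MeasurableSpace Ω] {d : ℕ}
    (S : ℕ → Ω → (Fin d → ℤ)) (P : Measure Ω) : Prop where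
  measurable : ∀ i, Measurable (S i)
  start : ∀ᵐ ω ∂P, S 0 ω = 0
  indep : iIndepFun (fun (i : ℕ) (ω : Ω) => S (i + 1) ω - S i ω) P
  law : ∀ i : ℕ, P.map (fun ω => S (i + 1) ω - S i ω) = uniformOn (unitSteps d)

/-- `|x|_+ = max (|x|, 1)`, where `|x|` is the Euclidean norm of the lattice point `x`. -/
noncomputable def plusNorm {d : ℕ} (x : Fin d → ℤ) : ℝ :=
  max ‖(WithLp.toLp 2 (fun k => (x k : ℝ)) : EuclideanSpace ℝ (Fin d))‖ 1

/-- The random variable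
`∑_{1 ≤ i, j₁, j₂ ≤ n} |S_i - T_{j₁}|_+^{-3} |S_i - T_{j₂}|_+^{-3}`. -/
noncomputable def errorSum {Ω : Type*} {d : ℕ} (S T : ℕ → Ω → (Fin d → ℤ)) (n : ℕ) (ω : Ω) : ℝ :=
  ∑ i ∈ Finset.Icc 1 n, ∑ j₁ ∈ Finset.Icc 1 n, ∑ j₂ ∈ Finset.Icc 1 n,
    plusNorm (S i ω - T j₁ ω) ^ (-3 : ℤ) * plusNorm (S i ω - T j₂ ω) ^ (-3 : ℤ)

/-- The random variable
`∑_{1 ≤ i_1, …, i_m ≤ n} ∑_{1 ≤ j_1, …, j_{2m} ≤ n}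
  ∏_{k=1}^m |S_{i_k} - T_{j_{2k-1}}|_+^{-3} |S_{i_k} - T_{j_{2k}}|_+^{-3}`,
with the indices `k` of `i_k` and `j_k` shifted to start at `0`. -/
noncomputable def errorMomentSum {Ω : Type*} {d : ℕ} (S T : ℕ → Ω → (Fin d → ℤ)) (n m : ℕ)
    (ω : Ω) : ℝ :=
  ∑ i ∈ Fintype.piFinset (fun _ : Fin m => Finset.Icc 1 n),
    ∑ j ∈ Fintype.piFinset (fun _ : Fin (2 * m) => Finset.Icc 1 n),
      ∏ k : Fin m,
        (plusNorm (S (i k) ω - T (j ⟨2 * k.val, by omega⟩) ω) ^ (-3 : ℤ) *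
          plusNorm (S (i k) ω - T (j ⟨2 * k.val + 1, by omega⟩) ω) ^ (-3 : ℤ))

/-! Put f(y) = (∑_j |y - T_j|^{-3})², so that the random variable is ∑_i f(S_i), and let G be the
potential operator up to time about n. Norms are smoothed and both time ranges are enlarged to 0, …,
n, at the price of a constant factor. By `integral_eq_pathMean` all expectations become uniform
averages over finite step sequences.

Given T, a Khas'minskii bound gives E[(∑_i f(S_i))^m] ≤ m! (max_x Gf(x))^m, with x running over a
cube that the walk cannot leave in n steps. Expanding the square, Gf(x) = ∑_{k,l} Q_x(T_k, T_l) with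
Q_x(a,b) = G(|·-a|^{-3} |·-b|^{-3})(x), which is `pairKernel`.

For fixed x, the same type of bound for pair functionals (`pathMean_pair_moment_le`) gives
E[Gf(x)^p] ≤ (2p)! (C log n)^p: the potential of Q_x in one argument is at most C|a-x|^{-2}, and the
potential of |·-x|^{-2} is at most C log n. Both estimates come from explicit functions compared
with the smoothed |x|^{-2}, which is strictly superharmonic in dimension 5 (`avg_inv_sq_le`).

The maximum over x is controlled by the sum of p-th moments over the order n^5 points of the cube.
Taking p of order m log n makes the number of points at most e^{O(p)}, so the maximum behaves in
m-th moment as if it were of size p² log n, that is m² (log n)³. Its m-th power and m^m ≤ e^m m!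
supply (m!)² (log n)^{3m}; the first Khas'minskii bound supplies the third factorial. -/

/-! ### Averaging operators and potentials of finite-step walks -/

section Walk

variable {V ι : Type*} [AddCommGroup V] [Fintype ι]

/-- The Markov operator of the walk whose steps are uniform among the vectors `e i`. -/
noncomputable def avg (e : ι → V) : (V → ℝ) →ₗ[ℝ] (V → ℝ) where
  toFun f x := (Fintype.card ι : ℝ)⁻¹ * ∑ i, f (x + e i)
  map_add' f g := by
    funext x
    simp [Finset.sum_add_distrib, mul_add]
  map_smul' c f := by
    funext x
    simp only [Pi.smul_apply, smul_eq_mul, RingHom.id_apply, ← Finset.mul_sum]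
    ring

theorem avg_apply (e : ι → V) (f : V → ℝ) (x : V) :
    avg e f x = (Fintype.card ι : ℝ)⁻¹ * ∑ i, f (x + e i) := rfl

/-- The potential operator of the walk, up to time `N`. -/
noncomputable def pot (e : ι → V) : ℕ → (V → ℝ) →ₗ[ℝ] (V → ℝ)
  | 0 => 0
  | N + 1 => LinearMap.id + avg e ∘ₗ pot e N

theorem pot_zero (e : ι → V) (f : V → ℝ) : pot e 0 f = 0 := rfl

theorem pot_succ (e : ι → V) (N : ℕ) (f : V → ℝ) :
    pot e (N + 1) f = f + avg e (pot e N f) := rfl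

theorem avg_mono (e : ι → V) {f g : V → ℝ} (h : ∀ x, f x ≤ g x) (x : V) :
    avg e f x ≤ avg e g x := by
  rw [avg_apply, avg_apply]
  gcongr with i
  exact h _

theorem avg_const [Nonempty ι] (e : ι → V) (c : ℝ) (x : V) : avg e (fun _ => c) x = c := by
  have : (Fintype.card ι : ℝ) ≠ 0 := by positivity
  simp [avg_apply, this]

theorem pot_mono (e : ι → V) (N : ℕ) {f g : V → ℝ} (h : ∀ x, f x ≤ g x) (x : V) :
    pot e N f x ≤ pot e N g x := by
  induction N generalizing x with
  | zero => simp [pot_zero]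
  | succ N ih =>
    rw [pot_succ, pot_succ]
    exact add_le_add (h x) (avg_mono e ih x)

theorem pot_nonneg (e : ι → V) (N : ℕ) {f : V → ℝ} (h : ∀ x, 0 ≤ f x) (x : V) :
    0 ≤ pot e N f x := by
  have := pot_mono e N (f := 0) (g := f) h x
  simpa using this

theorem pot_le_succ (e : ι → V) (N : ℕ) {f : V → ℝ} (h : ∀ x, 0 ≤ f x) (x : V) :
    pot e N f x ≤ pot e (N + 1) f x := by
  induction N generalizing x with
  | zero => simpa [pot_zero] using pot_nonneg e 1 h x
  | succ N ih =>
    rw [pot_succ, pot_succ e (N + 1)]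
    exact add_le_add le_rfl (avg_mono e ih x)

theorem pot_le_pot (e : ι → V) {M N : ℕ} (hMN : M ≤ N) {f : V → ℝ} (h : ∀ x, 0 ≤ f x) (x : V) :
    pot e M f x ≤ pot e N f x :=
  monotone_nat_of_le_succ (f := fun N => pot e N f x) (fun N => pot_le_succ e N h x) hMN

/-- A nonnegative supersolution of the Poisson equation dominates the potential. -/
theorem pot_le_of_supersolution (e : ι → V) (N : ℕ) {f u : V → ℝ} (hu : ∀ x, 0 ≤ u x)
    (h : ∀ x, f x + avg e u x ≤ u x) (x : V) : pot e N f x ≤ u x := by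
  induction N generalizing x with
  | zero => simpa [pot_zero] using hu x
  | succ N ih =>
    rw [pot_succ]
    exact (add_le_add le_rfl (avg_mono e ih x)).trans (h x)

theorem map_avg_swap {W : Type*} (e : ι → V) (L : (W → ℝ) →ₗ[ℝ] (W → ℝ)) (k : W → V → ℝ)
    (x : W) (w : V) :
    L (fun y => avg e (k y) w) x = avg e (fun b => L (fun y => k y b) x) w := by
  have : (fun y => avg e (k y) w)
      = (Fintype.card ι : ℝ)⁻¹ • ∑ i, fun y => k y (w + e i) := by
    funext y
    simp [avg_apply]
  rw [this, map_smul, map_sum, avg_apply]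
  simp

/-- A potential is a finite combination of translates, so every linear operator commutes with it;
this is a Fubini exchange for potentials in separate variables. -/
theorem map_pot_swap {W : Type*} (e : ι → V) (L : (W → ℝ) →ₗ[ℝ] (W → ℝ)) (N : ℕ)
    (k : W → V → ℝ) (x : W) (w : V) :
    L (fun y => pot e N (k y) w) x = pot e N (fun b => L (fun y => k y b) x) w := by
  induction N generalizing w with
  | zero =>
    simp only [pot_zero]
    exact congrFun (map_zero L) x
  | succ N ih =>
    have h : (fun y => pot e (N + 1) (k y) w)
        = (fun y => k y w) + fun y => avg e (pot e N (k y)) w := by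
      funext y
      simp [pot_succ]
    rw [h, map_add, Pi.add_apply, map_avg_swap, pot_succ, Pi.add_apply]
    exact congrArg (_ + ·) (congrFun (congrArg (avg e) (funext ih)) w)

/-- Jensen's inequality for the averaging operator, in tangent-line form. -/
theorem avg_le_affine [Nonempty ι] (e : ι → V) {f g : V → ℝ} {a b : ℝ} {x : V}
    (h : ∀ y, f y ≤ a + b * g y) : avg e f x ≤ a + b * avg e g x := by
  refine (avg_mono e h x).trans_eq ?_
  have : (fun y => a + b * g y) = (fun _ => a) + b • g := by
    funext y
    simp
  rw [this, map_add, map_smul, Pi.add_apply, avg_const]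
  simp

end Walk

/-! ### Potential estimates for the simple random walk on `ℤ^5` -/

/-- The nearest-neighbour steps, indexed by a coordinate and a sign. -/
def stepVec (d : ℕ) (s : Fin d × Bool) : Fin d → ℤ :=
  if s.2 then Pi.single s.1 1 else -Pi.single s.1 1

/-- The squared Euclidean norm of a lattice point. -/
noncomputable def sqNorm {d : ℕ} (x : Fin d → ℤ) : ℝ := ∑ k, (x k : ℝ) ^ 2

/-- A smoothed Euclidean norm. -/
noncomputable def smoothNorm {d : ℕ} (x : Fin d → ℤ) : ℝ := √(sqNorm x + 4)

theorem sqNorm_nonneg {d : ℕ} (x : Fin d → ℤ) : 0 ≤ sqNorm x :=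
  Finset.sum_nonneg fun _ _ => sq_nonneg _

theorem smoothNorm_sq {d : ℕ} (x : Fin d → ℤ) : smoothNorm x ^ 2 = sqNorm x + 4 :=
  Real.sq_sqrt (by linarith [sqNorm_nonneg x])

theorem two_le_smoothNorm {d : ℕ} (x : Fin d → ℤ) : 2 ≤ smoothNorm x :=
  Real.le_sqrt_of_sq_le (by linarith [sqNorm_nonneg x])

theorem smoothNorm_pos {d : ℕ} (x : Fin d → ℤ) : 0 < smoothNorm x := by
  linarith [two_le_smoothNorm x]

theorem sqNorm_neg {d : ℕ} (x : Fin d → ℤ) : sqNorm (-x) = sqNorm x := by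
  simp [sqNorm]

theorem smoothNorm_sub_comm {d : ℕ} (x y : Fin d → ℤ) :
    smoothNorm (x - y) = smoothNorm (y - x) := by
  rw [smoothNorm, smoothNorm, ← sqNorm_neg, neg_sub]

theorem sqNorm_add_single {d : ℕ} (x : Fin d → ℤ) (k : Fin d) (c : ℤ) :
    sqNorm (x + Pi.single k c) = sqNorm x + 2 * c * x k + c ^ 2 := by
  have h : ∀ l, (((x + Pi.single k c : Fin d → ℤ) l : ℤ) : ℝ) ^ 2
      = (x l : ℝ) ^ 2 + if l = k then 2 * (c : ℝ) * x k + (c : ℝ) ^ 2 else 0 := by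
    intro l
    by_cases hl : l = k
    · subst hl
      simp
      ring
    · simp [hl]
  rw [sqNorm, Finset.sum_congr rfl fun l _ => h l, Finset.sum_add_distrib]
  simp [sqNorm]
  ring

theorem abs_coord_le {d : ℕ} (x : Fin d → ℤ) (k : Fin d) : |(x k : ℝ)| ≤ smoothNorm x := by
  apply Real.le_sqrt_of_sq_le
  rw [sq_abs]
  have : (x k : ℝ) ^ 2 ≤ sqNorm x :=
    Finset.single_le_sum (f := fun k => (x k : ℝ) ^ 2) (fun _ _ => sq_nonneg _) (Finset.mem_univ k)
  linarith

theorem sqNorm_add_stepVec {d : ℕ} (x : Fin d → ℤ) (k : Fin d) (b : Bool) :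
    sqNorm (x + stepVec d (k, b)) = sqNorm x + 1 + if b then 2 * (x k : ℝ) else -(2 * (x k : ℝ)) := by
  cases b
  · have := sqNorm_add_single x k (-1)
    simp only [Pi.single_neg] at this
    simp only [stepVec, Bool.false_eq_true, if_false]
    rw [this]
    push_cast
    ring
  · have := sqNorm_add_single x k 1
    simp only [stepVec, if_true]
    rw [this]
    push_cast
    ring

theorem smoothNorm_add_stepVec_le {d : ℕ} (x : Fin d → ℤ) (s : Fin d × Bool) :
    smoothNorm (x + stepVec d s) ≤ smoothNorm x + 1 := by
  obtain ⟨k, b⟩ := s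
  apply Real.sqrt_le_iff.2 ⟨by linarith [smoothNorm_pos x], ?_⟩
  rw [sqNorm_add_stepVec]
  have h1 := abs_le.1 (abs_coord_le x k)
  have h2 := smoothNorm_sq x
  cases b <;> simp <;> nlinarith

/-- The inverse square of the smoothed norm is strictly superharmonic on `ℤ^5`. -/
theorem avg_inv_sq_le (x : Fin 5 → ℤ) :
    avg (stepVec 5) (fun y => (smoothNorm y ^ 2)⁻¹) x
      ≤ (smoothNorm x ^ 2)⁻¹ - (smoothNorm x ^ 4)⁻¹ / 10 := by
  have hpair : ∀ k : Fin 5,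
      (smoothNorm (x + stepVec 5 (k, true)) ^ 2)⁻¹ + (smoothNorm (x + stepVec 5 (k, false)) ^ 2)⁻¹
        ≤ 2 / (sqNorm x + 5) + 8 * (x k : ℝ) ^ 2 / ((sqNorm x + 5) ^ 2 * (sqNorm x + 1)) := by
    intro k
    have hk : (x k : ℝ) ^ 2 ≤ sqNorm x :=
      Finset.single_le_sum (f := fun k => (x k : ℝ) ^ 2) (fun _ _ => sq_nonneg _)
        (Finset.mem_univ k)
    rw [smoothNorm_sq, smoothNorm_sq, sqNorm_add_stepVec, sqNorm_add_stepVec]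
    simp only [if_true, Bool.false_eq_true, if_false]
    set q := sqNorm x
    set t : ℝ := (x k : ℝ)
    have h1 : 0 < q + 5 + 2 * t := by nlinarith [sq_nonneg (t + 1)]
    have h2 : 0 < q + 5 - 2 * t := by nlinarith [sq_nonneg (t - 1)]
    have hq : 0 ≤ q := (sq_nonneg t).trans hk
    have e1 : (q + 1 + 2 * t + 4)⁻¹ + (q + 1 + -(2 * t) + 4)⁻¹
        = 2 / (q + 5) + 8 * t ^ 2 / ((q + 5) * ((q + 5 + 2 * t) * (q + 5 - 2 * t))) := by
      have : q + 1 + 2 * t + 4 ≠ 0 := by linarith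
      have : q + 1 + -(2 * t) + 4 ≠ 0 := by linarith
      field_simp
      ring
    rw [e1]
    -- The last two factors multiply to (q + 5)² - 4t², at least (q + 5)(q + 1) because t² ≤ q.
    gcongr 2 / (q + 5) + 8 * t ^ 2 / ?_
    nlinarith
  have hsum : ∑ s : Fin 5 × Bool, (smoothNorm (x + stepVec 5 s) ^ 2)⁻¹
      ≤ 10 / (sqNorm x + 5) + 8 * sqNorm x / ((sqNorm x + 5) ^ 2 * (sqNorm x + 1)) := by
    rw [Fintype.sum_prod_type]
    calc _ ≤ ∑ k : Fin 5, (2 / (sqNorm x + 5)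
          + 8 * (x k : ℝ) ^ 2 / ((sqNorm x + 5) ^ 2 * (sqNorm x + 1))) := by
          apply Finset.sum_le_sum
          intro k _
          rw [Fintype.sum_bool]
          exact hpair k
      _ = _ := by
          rw [Finset.sum_add_distrib, ← Finset.sum_div _ _ ((sqNorm x + 5) ^ 2 * (sqNorm x + 1)),
            ← Finset.mul_sum]
          simp [sqNorm]
          ring
  rw [avg_apply]
  have hq := sqNorm_nonneg x
  have e4 : smoothNorm x ^ 4 = (sqNorm x + 4) ^ 2 := by rw [← smoothNorm_sq]; ring
  rw [e4, smoothNorm_sq]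
  have hc : (Fintype.card (Fin 5 × Bool) : ℝ) = 10 := by norm_num
  rw [hc]
  refine (mul_le_mul_of_nonneg_left hsum (by norm_num)).trans ?_
  set q := sqNorm x
  have key : (q + 4)⁻¹ - ((q + 4) ^ 2)⁻¹ / 10
      - 10⁻¹ * (10 / (q + 5) + 8 * q / ((q + 5) ^ 2 * (q + 1)))
      = ((10 * (q + 4) - (q + 5)) * (q + 5) * (q + 1) - 8 * q * (q + 4) ^ 2)
        / (10 * (q + 4) ^ 2 * (q + 5) ^ 2 * (q + 1)) := by
    field_simp
    ring
  have : 0 ≤ ((10 * (q + 4) - (q + 5)) * (q + 5) * (q + 1) - 8 * q * (q + 4) ^ 2)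
        / (10 * (q + 4) ^ 2 * (q + 5) ^ 2 * (q + 1)) := by
    apply div_nonneg
    -- The numerator is q³ + 25q² + 127q + 175. The continuum drift of r^{-2} is -(2/10) r^{-4};
    -- claiming only half of it leaves room for the lattice error.
    · nlinarith [mul_nonneg hq hq, mul_nonneg (mul_nonneg hq hq) hq]
    · positivity
  linarith

theorem avg_inv_sq_sub_le (a x : Fin 5 → ℤ) :
    avg (stepVec 5) (fun y => (smoothNorm (y - a) ^ 2)⁻¹) x
      ≤ (smoothNorm (x - a) ^ 2)⁻¹ - (smoothNorm (x - a) ^ 4)⁻¹ / 10 := by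
  have := avg_inv_sq_le (x - a)
  rw [avg_apply] at this ⊢
  simpa only [sub_add_eq_add_sub] using this

/-- With r the current and r' the next norm, 20/r' ≤ 10/r + 10r/r'² by AM-GM. Averaging and using
the drift of r^{-2} shows that 20/r loses at least r^{-3} in one step. -/
theorem pot_inv_cube_le (N : ℕ) (a x : Fin 5 → ℤ) :
    pot (stepVec 5) N (fun y => (smoothNorm (y - a) ^ 3)⁻¹) x ≤ 20 * (smoothNorm (x - a))⁻¹ := by
  refine pot_le_of_supersolution (stepVec 5) N
    (u := fun y => 20 * (smoothNorm (y - a))⁻¹) ?_ ?_ x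
  · intro y
    have := smoothNorm_pos (y - a)
    positivity
  · intro y
    have hr := smoothNorm_pos (y - a)
    have hj := avg_le_affine (stepVec 5) (x := y) (f := fun z => 20 * (smoothNorm (z - a))⁻¹)
      (g := fun z => (smoothNorm (z - a) ^ 2)⁻¹) (a := 10 * (smoothNorm (y - a))⁻¹)
      (b := 10 * smoothNorm (y - a)) (by
        intro z
        have hz := smoothNorm_pos (z - a)
        have : 10 * (smoothNorm (y - a))⁻¹ + 10 * smoothNorm (y - a) * (smoothNorm (z - a) ^ 2)⁻¹
            - 20 * (smoothNorm (z - a))⁻¹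
            = 10 * (smoothNorm (y - a) - smoothNorm (z - a)) ^ 2
              / (smoothNorm (y - a) * smoothNorm (z - a) ^ 2) := by
          field_simp
          ring
        have h0 : 0 ≤ 10 * (smoothNorm (y - a) - smoothNorm (z - a)) ^ 2
              / (smoothNorm (y - a) * smoothNorm (z - a) ^ 2) := by positivity
        show 20 * (smoothNorm (z - a))⁻¹ ≤ _
        linarith)
    have hs := mul_le_mul_of_nonneg_left (avg_inv_sq_sub_le a y)
      (show 0 ≤ 10 * smoothNorm (y - a) by positivity)
    have e : 10 * smoothNorm (y - a)
          * ((smoothNorm (y - a) ^ 2)⁻¹ - (smoothNorm (y - a) ^ 4)⁻¹ / 10)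
        = 10 * (smoothNorm (y - a))⁻¹ - (smoothNorm (y - a) ^ 3)⁻¹ := by
      field_simp
    linarith

/-- The tangent-plane inequality for the power mean of exponent `-1/2`. -/
theorem inv_sq_add_le {a b a' b' : ℝ} (ha : 0 < a) (hb : 0 < b) (ha' : 0 < a') (hb' : 0 < b') :
    ((a' + b') ^ 2)⁻¹
      ≤ ((a + b) ^ 3)⁻¹ * (a ^ 3 * (a' ^ 2)⁻¹ + b ^ 3 * (b' ^ 2)⁻¹) := by
  have tangent : ∀ t : ℝ, 0 < t → 3 - 2 * t ≤ (t ^ 2)⁻¹ := by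
    intro t ht
    rw [← sub_nonneg]
    have : (t ^ 2)⁻¹ - (3 - 2 * t) = (t - 1) ^ 2 * (1 + 2 * t) / t ^ 2 := by
      field_simp
      ring
    rw [this]
    positivity
  -- Equality holds when (a', b') = l (a, b). With this l the weighted mean of the two tangent
  -- arguments is 1, so the linear terms collapse to the left side.
  set l := (a' + b') / (a + b) with hl
  have hl0 : 0 < l := by positivity
  have h1 := mul_le_mul_of_nonneg_left (tangent (a' / (a * l)) (by positivity))
    (show 0 ≤ a * (l ^ 2)⁻¹ by positivity)
  have h2 := mul_le_mul_of_nonneg_left (tangent (b' / (b * l)) (by positivity))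
    (show 0 ≤ b * (l ^ 2)⁻¹ by positivity)
  have e1 : a * (l ^ 2)⁻¹ * ((a' / (a * l)) ^ 2)⁻¹ = a ^ 3 * (a' ^ 2)⁻¹ := by
    field_simp
  have e2 : b * (l ^ 2)⁻¹ * ((b' / (b * l)) ^ 2)⁻¹ = b ^ 3 * (b' ^ 2)⁻¹ := by
    field_simp
  have e3 : a * (l ^ 2)⁻¹ * (3 - 2 * (a' / (a * l))) + b * (l ^ 2)⁻¹ * (3 - 2 * (b' / (b * l)))
      = (a + b) ^ 3 * ((a' + b') ^ 2)⁻¹ := by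
    have : a * (l ^ 2)⁻¹ * (3 - 2 * (a' / (a * l))) + b * (l ^ 2)⁻¹ * (3 - 2 * (b' / (b * l)))
      = (l ^ 2)⁻¹ * (3 * (a + b) - 2 * ((a' + b') / l)) := by
      field_simp
      ring
    rw [this, hl]
    field_simp
    ring
  rw [e1] at h1
  rw [e2] at h2
  rw [inv_mul_eq_div, le_div_iff₀ (by positivity)]
  linarith

/-- The sum of the two norms to the power -2 is a concave function of their inverse squares. Its
tangent plane at the current point transfers the drifts of both inverse squares; only the drift from
`w` is kept. -/
theorem avg_inv_sq_add_le (a w y : Fin 5 → ℤ) :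
    avg (stepVec 5) (fun z => ((smoothNorm (z - a) + smoothNorm (z - w)) ^ 2)⁻¹) y
      ≤ ((smoothNorm (y - a) + smoothNorm (y - w)) ^ 2)⁻¹
        - ((smoothNorm (y - a) + smoothNorm (y - w)) ^ 3)⁻¹ * (smoothNorm (y - w))⁻¹ / 10 := by
  set α := smoothNorm (y - a) with hα
  set β := smoothNorm (y - w) with hβ
  have ha : 0 < α := smoothNorm_pos _
  have hb : 0 < β := smoothNorm_pos _
  have h1 : avg (stepVec 5) (fun z => ((smoothNorm (z - a) + smoothNorm (z - w)) ^ 2)⁻¹) y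
      ≤ avg (stepVec 5) ((((α + β) ^ 3)⁻¹ * α ^ 3) • (fun z => (smoothNorm (z - a) ^ 2)⁻¹)
        + (((α + β) ^ 3)⁻¹ * β ^ 3) • fun z => (smoothNorm (z - w) ^ 2)⁻¹) y := by
    apply avg_mono
    intro z
    refine (inv_sq_add_le ha hb (smoothNorm_pos (z - a)) (smoothNorm_pos (z - w))).trans_eq ?_
    simp
    ring
  rw [map_add, map_smul, map_smul] at h1
  simp only [Pi.add_apply, Pi.smul_apply, smul_eq_mul] at h1
  have h2 := mul_le_mul_of_nonneg_left (avg_inv_sq_sub_le a y)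
    (show 0 ≤ ((α + β) ^ 3)⁻¹ * α ^ 3 by positivity)
  have h3 := mul_le_mul_of_nonneg_left (avg_inv_sq_sub_le w y)
    (show 0 ≤ ((α + β) ^ 3)⁻¹ * β ^ 3 by positivity)
  rw [← hα] at h2
  rw [← hβ] at h3
  have e : ((α + β) ^ 3)⁻¹ * α ^ 3 * ((α ^ 2)⁻¹ - (α ^ 4)⁻¹ / 10)
      + ((α + β) ^ 3)⁻¹ * β ^ 3 * ((β ^ 2)⁻¹ - (β ^ 4)⁻¹ / 10)
      = ((α + β) ^ 2)⁻¹ - ((α + β) ^ 3)⁻¹ * β⁻¹ / 10 - ((α + β) ^ 3)⁻¹ * α⁻¹ / 10 := by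
    field_simp
    ring
  have : 0 ≤ ((α + β) ^ 3)⁻¹ * α⁻¹ / 10 := by positivity
  linarith

/-- With α, β the distances to `a`, `w`, the supersolution is 80(α+β)^{-2} + 10α^{-2}, with drift at
least 8(α+β)^{-3}β^{-1} + α^{-4}. The first term covers α^{-3}β^{-1} when β ≤ α, the second when α ≤
β. -/
theorem pot_inv_cube_mul_inv_le (N : ℕ) (a w x : Fin 5 → ℤ) :
    pot (stepVec 5) N (fun y => (smoothNorm (y - a) ^ 3)⁻¹ * (smoothNorm (y - w))⁻¹) x
      ≤ 90 * (smoothNorm (x - a) ^ 2)⁻¹ := by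
  have hsup := pot_le_of_supersolution (stepVec 5) N
    (f := fun y => (smoothNorm (y - a) ^ 3)⁻¹ * (smoothNorm (y - w))⁻¹)
    (u := (80 : ℝ) • (fun y => ((smoothNorm (y - a) + smoothNorm (y - w)) ^ 2)⁻¹)
      + (10 : ℝ) • fun y => (smoothNorm (y - a) ^ 2)⁻¹) ?_ ?_ x
  · refine hsup.trans ?_
    have ha := smoothNorm_pos (x - a)
    have hb := smoothNorm_pos (x - w)
    have : ((smoothNorm (x - a) + smoothNorm (x - w)) ^ 2)⁻¹ ≤ (smoothNorm (x - a) ^ 2)⁻¹ := by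
      gcongr
      linarith
    simp only [Pi.add_apply, Pi.smul_apply, smul_eq_mul]
    linarith
  · intro y
    have ha := smoothNorm_pos (y - a)
    have hb := smoothNorm_pos (y - w)
    simp only [Pi.add_apply, Pi.smul_apply, smul_eq_mul]
    positivity
  · intro y
    rw [map_add, map_smul, map_smul]
    simp only [Pi.add_apply, Pi.smul_apply, smul_eq_mul]
    have h1 := avg_inv_sq_add_le a w y
    have h2 := avg_inv_sq_sub_le a y
    set α := smoothNorm (y - a)
    set β := smoothNorm (y - w)
    have ha : 0 < α := smoothNorm_pos _
    have hb : 0 < β := smoothNorm_pos _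
    have hf : (α ^ 3)⁻¹ * β⁻¹ ≤ 8 * ((α + β) ^ 3)⁻¹ * β⁻¹ + (α ^ 4)⁻¹ := by
      rcases le_total β α with h | h
      · have : (α ^ 3)⁻¹ ≤ 8 * ((α + β) ^ 3)⁻¹ := by
          rw [← div_eq_mul_inv, inv_eq_one_div, div_le_div_iff₀ (by positivity) (by positivity)]
          have : (α + β) ^ 3 ≤ (2 * α) ^ 3 := by
            gcongr
            linarith
          nlinarith
        have h3 := mul_le_mul_of_nonneg_right this (inv_nonneg.2 hb.le)
        have : 0 ≤ (α ^ 4)⁻¹ := by positivity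
        linarith
      · have h3 : β⁻¹ ≤ α⁻¹ := by gcongr
        have h4 := mul_le_mul_of_nonneg_left h3 (show 0 ≤ (α ^ 3)⁻¹ by positivity)
        have h5 : (α ^ 3)⁻¹ * α⁻¹ = (α ^ 4)⁻¹ := by
          field_simp
        have : 0 ≤ 8 * ((α + β) ^ 3)⁻¹ * β⁻¹ := by positivity
        linarith
    linarith

/-- By log t ≤ t - 1 at t = r²/r'², the function -20 log r drops by at least r^{-2} on average in
one step. It is unbounded below, so 20 log(r + N) is added; as r grows by at most 1 per step,
lowering N by one compensates. -/
theorem pot_inv_sq_le_log (N : ℕ) (a x : Fin 5 → ℤ) :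
    pot (stepVec 5) N (fun y => (smoothNorm (y - a) ^ 2)⁻¹) x ≤ 20 * Real.log (1 + N) := by
  have key : ∀ x, pot (stepVec 5) N (fun y => (smoothNorm (y - a) ^ 2)⁻¹) x
      ≤ 20 * Real.log (smoothNorm (x - a) + N) - 20 * Real.log (smoothNorm (x - a)) := by
    induction N with
    | zero => intro x; simp [pot_zero]
    | succ N ih =>
      intro x
      rw [pot_succ, Pi.add_apply]
      have hr := smoothNorm_pos (x - a)
      set c := Real.log (smoothNorm (x - a)) with hc
      have h1 := avg_le_affine (stepVec 5) (x := x) (f := fun y => - 20 * Real.log (smoothNorm (y - a)))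
        (g := fun y => (smoothNorm (y - a) ^ 2)⁻¹) (a := -20 * c - 10)
        (b := 10 * smoothNorm (x - a) ^ 2) (by
          intro y
          have hy := smoothNorm_pos (y - a)
          have := Real.log_le_sub_one_of_pos
            (show 0 < smoothNorm (x - a) ^ 2 / smoothNorm (y - a) ^ 2 by positivity)
          rw [Real.log_div (by positivity) (by positivity), Real.log_pow, Real.log_pow] at this
          push_cast at this
          rw [div_eq_mul_inv] at this
          linarith)
      have h2 := mul_le_mul_of_nonneg_left (avg_inv_sq_sub_le a x)
        (show 0 ≤ 10 * smoothNorm (x - a) ^ 2 by positivity)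
      have e2 : 10 * smoothNorm (x - a) ^ 2
          * ((smoothNorm (x - a) ^ 2)⁻¹ - (smoothNorm (x - a) ^ 4)⁻¹ / 10)
          = 10 - (smoothNorm (x - a) ^ 2)⁻¹ := by
        field_simp
      have h3 : avg (stepVec 5) (pot (stepVec 5) N fun y => (smoothNorm (y - a) ^ 2)⁻¹) x
          ≤ avg (stepVec 5) ((fun y => 20 * Real.log (smoothNorm (y - a) + N))
            + fun y => -20 * Real.log (smoothNorm (y - a))) x := by
        apply avg_mono
        intro y
        refine (ih y).trans_eq ?_
        simp
        ring
      have h4 : avg (stepVec 5) (fun y => 20 * Real.log (smoothNorm (y - a) + N)) x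
          ≤ 20 * Real.log (smoothNorm (x - a) + (N + 1)) := by
        rw [avg_apply]
        have hc : (Fintype.card (Fin 5 × Bool) : ℝ) = 10 := by norm_num
        have : ∑ s : Fin 5 × Bool, 20 * Real.log (smoothNorm (x + stepVec 5 s - a) + N)
            ≤ ∑ s : Fin 5 × Bool, 20 * Real.log (smoothNorm (x - a) + (N + 1)) := by
          apply Finset.sum_le_sum
          intro s _
          have hs := smoothNorm_add_stepVec_le (x - a) s
          rw [sub_add_eq_add_sub] at hs
          have := smoothNorm_pos (x + stepVec 5 s - a)
          have := Real.log_le_log (by positivity)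
            (show smoothNorm (x + stepVec 5 s - a) + N ≤ smoothNorm (x - a) + (N + 1) by linarith)
          linarith
        rw [Finset.sum_const, Finset.card_univ, nsmul_eq_mul, hc] at this
        rw [hc]
        linarith
      rw [map_add, Pi.add_apply] at h3
      push_cast
      linarith
  refine (key x).trans ?_
  have hr := two_le_smoothNorm (x - a)
  have hN : (0 : ℝ) ≤ N := N.cast_nonneg
  rw [← mul_sub, ← Real.log_div (by positivity) (by positivity)]
  gcongr
  rw [div_le_iff₀ (by positivity)]
  nlinarith

/-! ### Expectations over the paths of a finite-step walk -/

section PathSum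

variable {V : Type*}

theorem pow_sub_pow_le_mul {x y : ℝ} (hx : 0 ≤ x) (hxy : x ≤ y) (p : ℕ) :
    y ^ p - x ^ p ≤ p * (y - x) * y ^ (p - 1) := by
  cases p with
  | zero => simp
  | succ p =>
    induction p with
    | zero => simp
    | succ p ih =>
      have h1 : y * (y ^ (p + 1) - x ^ (p + 1)) ≤ y * (((p + 1 : ℕ) : ℝ) * (y - x) * y ^ p) :=
        mul_le_mul_of_nonneg_left (by simpa using ih) (hx.trans hxy)
      have h2 : (y - x) * x ^ (p + 1) ≤ (y - x) * y ^ (p + 1) := by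
        have := sub_nonneg.2 hxy
        gcongr
      push_cast at h1 ⊢
      ring_nf at h1 h2 ⊢
      linarith

theorem pow_mul_pow_sub_le {x y u v : ℝ} (hx : 0 ≤ x) (hxy : x ≤ y) (hu : 0 ≤ u) (huv : u ≤ v)
    (p q : ℕ) :
    y ^ p * v ^ q - x ^ p * u ^ q
      ≤ p * (y - x) * (y ^ (p - 1) * v ^ q) + q * (v - u) * (y ^ p * v ^ (q - 1)) := by
  have h1 := mul_le_mul_of_nonneg_right (pow_sub_pow_le_mul hx hxy p)
    (pow_nonneg (hu.trans huv) q)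
  have h2 := mul_le_mul_of_nonneg_left (pow_sub_pow_le_mul hu huv q) (pow_nonneg hx p)
  have h3 : x ^ p * (q * (v - u) * v ^ (q - 1)) ≤ y ^ p * (q * (v - u) * v ^ (q - 1)) := by
    have := sub_nonneg.2 huv
    have := hu.trans huv
    gcongr
  linarith

/-- Partial sums of a function along a path. -/
def pathSum (h : V → ℝ) (j : ℕ) (π : ℕ → V) : ℝ := ∑ k ∈ Finset.range j, h (π k)

/-- Partial sums of a kernel along a path. -/
def pathPairSum (Q : V → V → ℝ) (j : ℕ) (π : ℕ → V) : ℝ :=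
  ∑ k ∈ Finset.range j, ∑ l ∈ Finset.range j, Q (π k) (π l)

theorem pathSum_nonneg {h : V → ℝ} (hh : ∀ x, 0 ≤ h x) (j : ℕ) (π : ℕ → V) : 0 ≤ pathSum h j π :=
  Finset.sum_nonneg fun _ _ => hh _

theorem pathPairSum_nonneg {Q : V → V → ℝ} (hQ : ∀ x y, 0 ≤ Q x y) (j : ℕ) (π : ℕ → V) :
    0 ≤ pathPairSum Q j π :=
  Finset.sum_nonneg fun _ _ => Finset.sum_nonneg fun _ _ => hQ _ _

theorem pathSum_mono {h : V → ℝ} (hh : ∀ x, 0 ≤ h x) (π : ℕ → V) :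
    Monotone fun j => pathSum h j π := fun _ _ hij =>
  Finset.sum_le_sum_of_subset_of_nonneg (Finset.range_mono hij) fun _ _ _ => hh _

theorem pathPairSum_mono {Q : V → V → ℝ} (hQ : ∀ x y, 0 ≤ Q x y) (π : ℕ → V) :
    Monotone fun j => pathPairSum Q j π := fun _ _ hij =>
  (Finset.sum_le_sum fun _ _ => Finset.sum_le_sum_of_subset_of_nonneg (Finset.range_mono hij)
    fun _ _ _ => hQ _ _).trans
  (Finset.sum_le_sum_of_subset_of_nonneg (Finset.range_mono hij)
    fun _ _ _ => Finset.sum_nonneg fun _ _ => hQ _ _)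

/-- The new terms are a row, a column and one diagonal entry; symmetry merges row and column, and
the diagonal is counted twice. -/
theorem pathPairSum_succ_sub_le {Q : V → V → ℝ} (hQ : ∀ x y, 0 ≤ Q x y)
    (hsymm : ∀ x y, Q x y = Q y x) (j : ℕ) (π : ℕ → V) :
    pathPairSum Q (j + 1) π - pathPairSum Q j π
      ≤ 2 * ∑ l ∈ Finset.range (j + 1), Q (π l) (π j) := by
  simp only [pathPairSum, Finset.sum_range_succ, Finset.sum_add_distrib]
  have : ∑ l ∈ Finset.range j, Q (π j) (π l) = ∑ l ∈ Finset.range j, Q (π l) (π j) :=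
    Finset.sum_congr rfl fun l _ => hsymm _ _
  rw [this]
  linarith [hQ (π j) (π j)]

theorem dependsOn_pathSum (h : V → ℝ) (j : ℕ) :
    DependsOn (pathSum h (j + 1)) (Set.Iic j) := fun π π' hπ =>
  Finset.sum_congr rfl fun k hk => by
    rw [hπ k (by simpa [Nat.lt_succ_iff] using hk)]

theorem dependsOn_pathPairSum (Q : V → V → ℝ) (j : ℕ) :
    DependsOn (pathPairSum Q (j + 1)) (Set.Iic j) := fun π π' hπ =>
  Finset.sum_congr rfl fun k hk => Finset.sum_congr rfl fun l hl => by
    rw [hπ k (by simpa [Nat.lt_succ_iff] using hk), hπ l (by simpa [Nat.lt_succ_iff] using hl)]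

/-- Pathwise bound of a mixed power of additive functionals by the sum over the last index. -/
theorem pathPairSum_pow_mul_pathSum_pow_le {Q : V → V → ℝ} {h : V → ℝ} (hQ : ∀ x y, 0 ≤ Q x y)
    (hsymm : ∀ x y, Q x y = Q y x) (hh : ∀ x, 0 ≤ h x) {p q : ℕ} (hpq : 0 < p + q) (N : ℕ)
    (π : ℕ → V) :
    pathPairSum Q N π ^ p * pathSum h N π ^ q
      ≤ 2 * p * ∑ l ∈ Finset.range N, ∑ j ∈ Finset.range N,
          Q (π l) (π j) * (if l ≤ j then
            pathPairSum Q (j + 1) π ^ (p - 1) * pathSum h (j + 1) π ^ q else 0)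
        + q * ∑ j ∈ Finset.range N,
          h (π j) * (pathPairSum Q (j + 1) π ^ p * pathSum h (j + 1) π ^ (q - 1)) := by
  have h0 : pathPairSum Q 0 π ^ p * pathSum h 0 π ^ q = 0 := by
    rcases Nat.eq_zero_or_pos p with rfl | hp
    · have : q ≠ 0 := by omega
      simp [pathSum, this]
    · simp [pathPairSum, hp.ne']
  have htel := Finset.sum_range_sub
    (fun j => pathPairSum Q j π ^ p * pathSum h j π ^ q) N
  rw [h0, sub_zero] at htel
  rw [← htel, Finset.sum_comm, Finset.mul_sum, Finset.mul_sum, ← Finset.sum_add_distrib]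
  refine Finset.sum_le_sum fun j hj => ?_
  refine (pow_mul_pow_sub_le (pathPairSum_nonneg hQ j π) (pathPairSum_mono hQ π j.le_succ)
    (pathSum_nonneg hh j π) (pathSum_mono hh π j.le_succ) p q).trans ?_
  have e1 : pathSum h (j + 1) π - pathSum h j π = h (π j) := by
    simp [pathSum, Finset.sum_range_succ]
  simp only [Nat.succ_eq_add_one]
  rw [e1]
  have h2 := pathPairSum_succ_sub_le hQ hsymm j π
  have e3 : ∑ l ∈ Finset.range N, Q (π l) (π j) * (if l ≤ j then
            pathPairSum Q (j + 1) π ^ (p - 1) * pathSum h (j + 1) π ^ q else 0)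
      = (∑ l ∈ Finset.range (j + 1), Q (π l) (π j))
        * (pathPairSum Q (j + 1) π ^ (p - 1) * pathSum h (j + 1) π ^ q) := by
    rw [Finset.sum_mul]
    have hsub : Finset.range (j + 1) ⊆ Finset.range N :=
      Finset.range_mono (Finset.mem_range.1 hj)
    rw [← Finset.sum_subset hsub]
    · refine Finset.sum_congr rfl fun l hl => ?_
      rw [if_pos (Nat.lt_succ_iff.1 (Finset.mem_range.1 hl))]
    · intro l _ hl
      rw [if_neg (by simpa [Nat.lt_succ_iff] using hl), mul_zero]
  rw [e3]
  have h4 : 0 ≤ pathPairSum Q (j + 1) π ^ (p - 1) * pathSum h (j + 1) π ^ q :=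
    mul_nonneg (pow_nonneg (pathPairSum_nonneg hQ _ _) _) (pow_nonneg (pathSum_nonneg hh _ _) _)
  have h5 := mul_le_mul_of_nonneg_left (mul_le_mul_of_nonneg_right h2 h4) p.cast_nonneg
  refine add_le_add ?_ (by rw [mul_assoc])
  calc _ = (p : ℝ) * ((pathPairSum Q (j + 1) π - pathPairSum Q j π)
        * (pathPairSum Q (j + 1) π ^ (p - 1) * pathSum h (j + 1) π ^ q)) := by ring
    _ ≤ _ := h5
    _ = _ := by ring

end PathSum

section PathMean

variable {V ι : Type*} [AddCommGroup V]

/-- The path from the origin with steps `e (s 0), e (s 1), …`, stopped after `n` steps. -/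
def walkPath (e : ι → V) {n : ℕ} (s : Fin n → ι) (j : ℕ) : V :=
  ∑ i : Fin n, if i.val < j then e (s i) else 0

theorem walkPath_zero (e : ι → V) {n : ℕ} (s : Fin n → ι) : walkPath e s 0 = 0 := by
  simp [walkPath]

theorem walkPath_succ (e : ι → V) {n : ℕ} (s : Fin n → ι) {j : ℕ} (hj : j < n) :
    walkPath e s (j + 1) = walkPath e s j + e (s ⟨j, hj⟩) := by
  have : e (s ⟨j, hj⟩) = ∑ i : Fin n, if i = ⟨j, hj⟩ then e (s i) else 0 := by simp
  rw [this, walkPath, walkPath, ← Finset.sum_add_distrib]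
  refine Finset.sum_congr rfl fun i _ => ?_
  by_cases h : i = ⟨j, hj⟩
  · subst h
    simp
  · have h' : i.val ≠ j := fun h' => h (Fin.ext h')
    have : i.val < j + 1 ↔ i.val < j := by omega
    simp [h, this]

theorem walkPath_update (e : ι → V) {n : ℕ} (s : Fin n → ι) (i : Fin n) (c : ι) {j : ℕ}
    (hj : j ≤ i) : walkPath e (Function.update s i c) j = walkPath e s j := by
  refine Finset.sum_congr rfl fun k _ => ?_
  by_cases hk : k.val < j
  · have : k ≠ i := by
      rintro rfl
      omega
    simp [this]
  · simp [hk]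

variable [Fintype ι]

/-- The mean of a path functional over the `n`-step walks from the origin. -/
noncomputable def pathMean (e : ι → V) (n : ℕ) : ((ℕ → V) → ℝ) →ₗ[ℝ] ℝ where
  toFun F := ((Fintype.card ι : ℝ)⁻¹) ^ n * ∑ s : Fin n → ι, F (walkPath e s)
  map_add' F G := by simp [Finset.sum_add_distrib, mul_add]
  map_smul' c F := by
    simp only [Pi.smul_apply, smul_eq_mul, RingHom.id_apply, ← Finset.mul_sum]
    ring

theorem pathMean_apply (e : ι → V) (n : ℕ) (F : (ℕ → V) → ℝ) :
    pathMean e n F = ((Fintype.card ι : ℝ)⁻¹) ^ n * ∑ s : Fin n → ι, F (walkPath e s) := rfl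

theorem pathMean_mono' (e : ι → V) (n : ℕ) {F G : (ℕ → V) → ℝ}
    (h : ∀ s : Fin n → ι, F (walkPath e s) ≤ G (walkPath e s)) :
    pathMean e n F ≤ pathMean e n G := by
  rw [pathMean_apply, pathMean_apply]
  gcongr with s
  exact h s

theorem pathMean_mono (e : ι → V) (n : ℕ) {F G : (ℕ → V) → ℝ} (h : ∀ π, F π ≤ G π) :
    pathMean e n F ≤ pathMean e n G :=
  pathMean_mono' e n fun _ => h _

theorem pathMean_const [Nonempty ι] (e : ι → V) (n : ℕ) (c : ℝ) :
    pathMean e n (fun _ => c) = c := by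
  have : (Fintype.card ι : ℝ) ≠ 0 := by positivity
  simp [pathMean_apply, this]

theorem pathMean_const_mul (e : ι → V) (n : ℕ) (c : ℝ) (F : (ℕ → V) → ℝ) :
    pathMean e n (fun π => c * F π) = c * pathMean e n F :=
  map_smul (pathMean e n) c F

theorem pathMean_add (e : ι → V) (n : ℕ) (F G : (ℕ → V) → ℝ) :
    pathMean e n (fun π => F π + G π) = pathMean e n F + pathMean e n G :=
  map_add (pathMean e n) F G

theorem pathMean_sum (e : ι → V) (n : ℕ) {κ : Type*} (t : Finset κ) (F : κ → (ℕ → V) → ℝ) :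
    pathMean e n (fun π => ∑ k ∈ t, F k π) = ∑ k ∈ t, pathMean e n (F k) := by
  rw [← map_sum]
  congr 1
  funext π
  simp

/-- Resampling one coordinate preserves the uniform law: exchanging `s i` with the fresh value `c`
is an involution of the pairs. -/
theorem sum_sum_update {ι κ : Type*} [Fintype ι] [Fintype κ] [DecidableEq κ] (i : κ)
    (G : (κ → ι) → ℝ) :
    ∑ s : κ → ι, ∑ c : ι, G (Function.update s i c) = Fintype.card ι * ∑ s : κ → ι, G s := by
  have hinv : Function.Involutive
      fun p : (κ → ι) × ι => (Function.update p.1 i p.2, p.1 i) := by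
    rintro ⟨s, c⟩
    simp
  rw [← Fintype.sum_prod_type' (fun s c => G (Function.update s i c))]
  have := Equiv.sum_comp hinv.toPerm (fun p : (κ → ι) × ι => G p.1)
  simp only [Function.Involutive.coe_toPerm] at this
  rw [this, Fintype.sum_prod_type, Finset.mul_sum]
  simp

/-- The Markov property at a fixed time. -/
theorem pathMean_markov [Nonempty ι] (e : ι → V) {n i : ℕ} (hi : i < n) (F : (ℕ → V) → V → ℝ)
    (hF : ∀ x, DependsOn (fun π => F π x) (Set.Iic i)) :
    pathMean e n (fun π => F π (π (i + 1))) = pathMean e n (fun π => avg e (F π) (π i)) := by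
  have hc : (Fintype.card ι : ℝ) ≠ 0 := by positivity
  simp only [pathMean_apply, avg_apply]
  congr 1
  have h := sum_sum_update (⟨i, hi⟩ : Fin n)
    (fun s : Fin n → ι => F (walkPath e s) (walkPath e s (i + 1)))
  rw [← Finset.mul_sum, eq_comm, inv_mul_eq_div, div_eq_iff hc, mul_comm, ← h]
  refine Finset.sum_congr rfl fun s _ => Finset.sum_congr rfl fun c _ => ?_
  rw [walkPath_succ e _ hi, walkPath_update e s ⟨i, hi⟩ c le_rfl, Function.update_self]
  refine (hF _ fun j hj => ?_).symm
  exact walkPath_update e s ⟨i, hi⟩ c hj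

/-- Summation of a kernel along the path against an adapted nondecreasing process: the kernel
may be replaced by a bound of its potential. -/
theorem pathMean_sum_kernel_le [Nonempty ι] (e : ι → V) (n l : ℕ) {B : Set V}
    (hB : ∀ (s : Fin n → ι), ∀ j ≤ n, walkPath e s j ∈ B)
    {q : V → V → ℝ} {h : V → ℝ} (hq : ∀ a, ∀ w ∈ B, pot e (n + 1) (q a) w ≤ h a)
    (hq0 : ∀ a b, 0 ≤ q a b) {Y : ℕ → (ℕ → V) → ℝ} (hY0 : ∀ j π, 0 ≤ Y j π)
    (hdep : ∀ j, DependsOn (Y j) (Set.Iic j)) (hmono : ∀ π, Monotone fun j => Y j π)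
    (hl : ∀ j < l, ∀ π, Y j π = 0) :
    pathMean e n (fun π => ∑ j ∈ Finset.range (n + 1), q (π l) (π j) * Y j π)
      ≤ pathMean e n (fun π => h (π l) * Y n π) := by
  -- Summation by parts in time: the terms before t have been paid, and `Y t` times the remaining
  -- potential is the conditional mean of the rest if `Y` were frozen at t. Each later increment of
  -- `Y` costs at most `h (π l)`.
  have key : ∀ t ≤ n, pathMean e n (fun π => ∑ j ∈ Finset.range t, q (π l) (π j) * Y j π
      + Y t π * pot e (n + 1 - t) (q (π l)) (π t)) ≤ pathMean e n (fun π => h (π l) * Y t π) := by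
    intro t ht
    induction t with
    | zero =>
      refine pathMean_mono' e n fun s => ?_
      have := mul_le_mul_of_nonneg_left (hq (walkPath e s l) _ (hB s 0 (Nat.zero_le _)))
        (hY0 0 (walkPath e s))
      simpa [mul_comm] using this
    | succ t ih =>
      have hM := pathMean_markov e (show t < n by omega)
        (fun π x => Y t π * pot e (n - t) (q (π l)) x) (by
          intro x π π' hπ
          -- If t < l, the point `π l` is not yet known at time t, but then `Y t` vanishes.
          by_cases hlt : t < l
          · simp [hl t hlt]
          · simp only [hdep t hπ, hπ l (by simpa using hlt)])
      obtain ⟨G, hG⟩ : ∃ G : (ℕ → V) → ℝ, G = fun π =>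
          (∑ j ∈ Finset.range t, q (π l) (π j) * Y j π + q (π l) (π t) * Y t π
            + h (π l) * (Y (t + 1) π - Y t π))
            + Y t π * pot e (n - t) (q (π l)) (π (t + 1)) := ⟨_, rfl⟩
      have hsplit : ∀ s : Fin n → ι, ∀ π, π = walkPath e s →
          ∑ j ∈ Finset.range (t + 1), q (π l) (π j) * Y j π
            + Y (t + 1) π * pot e (n + 1 - (t + 1)) (q (π l)) (π (t + 1))
          ≤ G π := by
        intro s π hπ
        simp only [hG]
        have hB' : π (t + 1) ∈ B := hπ ▸ hB s (t + 1) ht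
        have h1 : pot e (n - t) (q (π l)) (π (t + 1)) ≤ h (π l) :=
          (pot_le_pot e (by omega) (hq0 _) _).trans (hq _ _ hB')
        have h2 := mul_le_mul_of_nonneg_left h1 (sub_nonneg.2 (hmono π (Nat.le_succ t)))
        rw [Finset.sum_range_succ, Nat.add_sub_add_right]
        linarith
      refine (pathMean_mono' e n (G := G) fun s => hsplit s _ rfl).trans ?_
      rw [hG, pathMean_add, hM, ← pathMean_add]
      have ih' := ih (by omega)
      have hrw : ∀ π : ℕ → V,
          (∑ j ∈ Finset.range t, q (π l) (π j) * Y j π + q (π l) (π t) * Y t π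
            + h (π l) * (Y (t + 1) π - Y t π))
            + avg e (fun x => Y t π * pot e (n - t) (q (π l)) x) (π t)
          = (∑ j ∈ Finset.range t, q (π l) (π j) * Y j π
              + Y t π * pot e (n + 1 - t) (q (π l)) (π t))
            + h (π l) * (Y (t + 1) π - Y t π) := by
        intro π
        have e1 : avg e (fun x => Y t π * pot e (n - t) (q (π l)) x) (π t)
            = Y t π * avg e (pot e (n - t) (q (π l))) (π t) :=
          congrFun (map_smul (avg e) (Y t π) (pot e (n - t) (q (π l)))) (π t)
        rw [e1, show n + 1 - t = (n - t) + 1 by omega, pot_succ, Pi.add_apply]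
        ring
      simp only [hrw]
      rw [pathMean_add]
      have e2 : pathMean e n (fun π => h (π l) * (Y (t + 1) π - Y t π))
          = pathMean e n (fun π => h (π l) * Y (t + 1) π)
            - pathMean e n (fun π => h (π l) * Y t π) := by
        rw [← map_sub]
        congr 1
        funext π
        simp [mul_sub]
      rw [e2]
      linarith
  have hn := key n le_rfl
  refine le_trans (pathMean_mono e n fun π => ?_) hn
  rw [Finset.sum_range_succ, Nat.add_sub_cancel_left, pot_succ]
  simp [pot_zero, mul_comm]

/-- Moments of additive and pair functionals of the walk (a Khas'minskii-type bound). -/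
theorem pathMean_pair_moment_le [Nonempty ι] (e : ι → V) (n : ℕ) {B : Set V}
    (hB : ∀ (s : Fin n → ι), ∀ j ≤ n, walkPath e s j ∈ B)
    {Q : V → V → ℝ} {h : V → ℝ} {K : ℝ} (hK : 0 ≤ K) (hQ : ∀ x y, 0 ≤ Q x y)
    (hsymm : ∀ x y, Q x y = Q y x) (hh : ∀ x, 0 ≤ h x)
    (hQh : ∀ a, ∀ w ∈ B, pot e (n + 1) (Q a) w ≤ h a)
    (hhK : ∀ w ∈ B, pot e (n + 1) h w ≤ K) (p q : ℕ) :
    pathMean e n (fun π => pathPairSum Q (n + 1) π ^ p * pathSum h (n + 1) π ^ q)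
      ≤ ((2 * p + q) ! : ℝ) * K ^ (p + q) := by
  -- The weight counts path points: two per pair sum, one per single sum. Integrating out the last
  -- point gives E[Q^p H^q] ≤ 2p E[Q^{p-1} H^{q+1}] + qK E[Q^p H^{q-1}]. Both terms have weight one
  -- less, and 2p + q builds the factorial.
  induction hr : 2 * p + q generalizing p q with
  | zero =>
    obtain ⟨rfl, rfl⟩ : p = 0 ∧ q = 0 := by omega
    simp [pathMean_const]
  | succ r ih =>
    have hX0 : ∀ (p q j : ℕ) π, 0 ≤ pathPairSum Q j π ^ p * pathSum h j π ^ q := fun p q j π =>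
      mul_nonneg (pow_nonneg (pathPairSum_nonneg hQ _ _) _) (pow_nonneg (pathSum_nonneg hh _ _) _)
    have hXm : ∀ (p q : ℕ) π,
        Monotone fun j => pathPairSum Q (j + 1) π ^ p * pathSum h (j + 1) π ^ q := by
      intro p q π i j hij
      have h1 := pathPairSum_mono hQ π (Nat.succ_le_succ hij)
      have h2 := pathSum_mono hh π (Nat.succ_le_succ hij)
      exact mul_le_mul (pow_le_pow_left₀ (pathPairSum_nonneg hQ _ _) h1 _)
        (pow_le_pow_left₀ (pathSum_nonneg hh _ _) h2 _) (pow_nonneg (pathSum_nonneg hh _ _) _)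
        (pow_nonneg (pathPairSum_nonneg hQ _ _) _)
    have hXd : ∀ p q j : ℕ, DependsOn
        (fun π => pathPairSum Q (j + 1) π ^ p * pathSum h (j + 1) π ^ q) (Set.Iic j) := by
      intro p q j π π' hπ
      simp only [dependsOn_pathPairSum Q j hπ, dependsOn_pathSum h j hπ]
    refine (pathMean_mono e n fun π => pathPairSum_pow_mul_pathSum_pow_le hQ hsymm hh
      (show 0 < p + q by omega) (n + 1) π).trans ?_
    rw [pathMean_add, pathMean_const_mul, pathMean_const_mul]
    have hpair : ∀ l ∈ Finset.range (n + 1),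
        pathMean e n (fun π => ∑ j ∈ Finset.range (n + 1),
          Q (π l) (π j) * (if l ≤ j then
            pathPairSum Q (j + 1) π ^ (p - 1) * pathSum h (j + 1) π ^ q else 0))
        ≤ pathMean e n (fun π => h (π l)
          * (pathPairSum Q (n + 1) π ^ (p - 1) * pathSum h (n + 1) π ^ q)) := by
      intro l hl
      have := pathMean_sum_kernel_le e n l hB hQh hQ (Y := fun j π => if l ≤ j then
            pathPairSum Q (j + 1) π ^ (p - 1) * pathSum h (j + 1) π ^ q else 0) ?_ ?_ ?_ ?_
      · rw [Finset.mem_range, Nat.lt_succ_iff] at hl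
        simpa only [if_pos hl] using this
      · intro j π
        split_ifs
        · exact hX0 _ _ _ _
        · exact le_rfl
      · intro j
        by_cases hlj : l ≤ j
        · simp only [if_pos hlj]
          exact hXd _ _ _
        · simp only [if_neg hlj]
          intro π π' _
          rfl
      · intro π i j hij
        dsimp only
        split_ifs with h1 h2 h2
        · exact hXm _ _ _ hij
        · exact absurd (h1.trans hij) h2
        · exact hX0 _ _ _ _
        · exact le_rfl
      · intro j hj π
        exact if_neg (by omega)
    have hsingle := pathMean_sum_kernel_le e n 0 hB (q := fun _ => h) (h := fun _ => K)
      (fun _ => hhK) (fun _ => hh)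
      (Y := fun j π => pathPairSum Q (j + 1) π ^ p * pathSum h (j + 1) π ^ (q - 1))
      (fun _ _ => hX0 _ _ _ _) (fun _ => hXd _ _ _) (fun _ => hXm _ _ _) (by simp)
    rw [pathMean_const_mul] at hsingle
    have hpair' := Finset.sum_le_sum hpair
    rw [← pathMean_sum, ← pathMean_sum] at hpair'
    have e1 : ∀ π : ℕ → V, ∑ l ∈ Finset.range (n + 1), h (π l)
          * (pathPairSum Q (n + 1) π ^ (p - 1) * pathSum h (n + 1) π ^ q)
        = pathPairSum Q (n + 1) π ^ (p - 1) * pathSum h (n + 1) π ^ (q + 1) := by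
      intro π
      rw [← Finset.sum_mul, ← pathSum, pow_succ]
      ring
    simp only [e1] at hpair'
    have b1 : 2 * (p : ℝ) * pathMean e n
        (fun π => pathPairSum Q (n + 1) π ^ (p - 1) * pathSum h (n + 1) π ^ (q + 1))
        ≤ 2 * p * ((r ! : ℝ) * K ^ (p + q)) := by
      rcases Nat.eq_zero_or_pos p with rfl | hp
      · simp
      · have := ih (p - 1) (q + 1) (by omega)
        rw [show p - 1 + (q + 1) = p + q by omega] at this
        gcongr
    have b2 : (q : ℝ) * (K * pathMean e n
        (fun π => pathPairSum Q (n + 1) π ^ p * pathSum h (n + 1) π ^ (q - 1)))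
        ≤ q * ((r ! : ℝ) * K ^ (p + q)) := by
      rcases Nat.eq_zero_or_pos q with rfl | hq
      · simp
      · have := mul_le_mul_of_nonneg_left (ih p (q - 1) (by omega)) hK
        rw [show p + q = p + (q - 1) + 1 by omega, pow_succ]
        refine mul_le_mul_of_nonneg_left (this.trans_eq ?_) q.cast_nonneg
        ring
    refine (add_le_add (mul_le_mul_of_nonneg_left hpair' (by positivity))
      (mul_le_mul_of_nonneg_left hsingle q.cast_nonneg)).trans
      ((add_le_add b1 b2).trans_eq ?_)
    rw [Nat.factorial_succ, ← hr]
    push_cast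
    ring

end PathMean

/-! ### The interaction functional of two walks on `ℤ^5` -/

theorem abs_stepVec_le {d : ℕ} (s : Fin d × Bool) (k : Fin d) : |stepVec d s k| ≤ 1 := by
  obtain ⟨l, b⟩ := s
  by_cases h : k = l
  · subst h
    cases b <;> simp [stepVec]
  · cases b <;> simp [stepVec, h]

/-- The lattice points of the cube of side `2 n` around the origin. -/
noncomputable def cube (d n : ℕ) : Finset (Fin d → ℤ) :=
  Fintype.piFinset fun _ => Finset.Icc (-(n : ℤ)) n

theorem card_cube (d n : ℕ) : (cube d n).card = (2 * n + 1) ^ d := by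
  have : ((n : ℤ) + 1 + n).toNat = 2 * n + 1 := by omega
  simp [cube, this]

theorem walkPath_mem_cube {d n : ℕ} (s : Fin n → Fin d × Bool) {j : ℕ} (hj : j ≤ n) :
    walkPath (stepVec d) s j ∈ cube d n := by
  have key : ∀ j ≤ n, ∀ k, |walkPath (stepVec d) s j k| ≤ (j : ℤ) := by
    intro j hj k
    induction j with
    | zero => simp [walkPath_zero]
    | succ j ih =>
      rw [walkPath_succ _ _ hj, Pi.add_apply]
      have h1 := ih (by omega)
      have h2 := abs_stepVec_le (s ⟨j, hj⟩) k
      have h3 := abs_add_le (walkPath (stepVec d) s j k) (stepVec d (s ⟨j, hj⟩) k)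
      push_cast
      linarith
  rw [cube, Fintype.mem_piFinset]
  intro k
  have h := abs_le.1 (key j hj k)
  rw [Finset.mem_Icc]
  constructor <;> omega

/-- The smoothed inverse cube of the norm. -/
noncomputable def invCube (x : Fin 5 → ℤ) : ℝ := (smoothNorm x ^ 3)⁻¹

theorem invCube_nonneg (x : Fin 5 → ℤ) : 0 ≤ invCube x := by
  have := smoothNorm_pos x
  unfold invCube
  positivity

/-- The potential at `x` of the product of two inverse cubes centred at `a` and `b`. -/
noncomputable def pairKernel (N : ℕ) (x a b : Fin 5 → ℤ) : ℝ :=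
  pot (stepVec 5) N (fun y => invCube (y - a) * invCube (y - b)) x

theorem pairKernel_nonneg (N : ℕ) (x a b : Fin 5 → ℤ) : 0 ≤ pairKernel N x a b :=
  pot_nonneg _ _ (fun _ => mul_nonneg (invCube_nonneg _) (invCube_nonneg _)) _

theorem pairKernel_comm (N : ℕ) (x a b : Fin 5 → ℤ) : pairKernel N x a b = pairKernel N x b a := by
  simp only [pairKernel, mul_comm]

/-- After exchanging the two potentials, the one in `b` turns |y-b|^{-3} into 20|y-w|^{-1}, and the
one in `y` is then 90|x-a|^{-2}, uniformly in `w`. -/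
theorem pot_pairKernel_le (N : ℕ) (x a w : Fin 5 → ℤ) :
    pot (stepVec 5) N (pairKernel N x a) w ≤ 1800 * (smoothNorm (a - x) ^ 2)⁻¹ := by
  have hswap := map_pot_swap (stepVec 5) (pot (stepVec 5) N) N
    (fun y b => invCube (y - a) * invCube (y - b)) x w
  have hinner : ∀ y, pot (stepVec 5) N (fun b => invCube (y - a) * invCube (y - b)) w
      ≤ 20 * ((smoothNorm (y - a) ^ 3)⁻¹ * (smoothNorm (y - w))⁻¹) := by
    intro y
    have e1 : (fun b => invCube (y - a) * invCube (y - b))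
        = invCube (y - a) • fun b => (smoothNorm (b - y) ^ 3)⁻¹ := by
      funext b
      simp [invCube, smoothNorm_sub_comm y b]
    rw [e1, map_smul, Pi.smul_apply, smul_eq_mul]
    have := mul_le_mul_of_nonneg_left (pot_inv_cube_le N y w) (invCube_nonneg (y - a))
    rw [smoothNorm_sub_comm w y] at this
    refine this.trans_eq ?_
    rw [invCube]
    ring
  have h2 := pot_mono (stepVec 5) N hinner x
  have e3 : (fun y => 20 * ((smoothNorm (y - a) ^ 3)⁻¹ * (smoothNorm (y - w))⁻¹))
      = (20 : ℝ) • fun y => (smoothNorm (y - a) ^ 3)⁻¹ * (smoothNorm (y - w))⁻¹ := rfl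
  rw [hswap, e3, map_smul, Pi.smul_apply, smul_eq_mul] at h2
  have h3 := pot_inv_cube_mul_inv_le N a w x
  rw [smoothNorm_sub_comm x a] at h3
  exact h2.trans (by linarith)

theorem pathMean_pairKernel_pow_le (n p : ℕ) (x : Fin 5 → ℤ) :
    pathMean (stepVec 5) n (fun π => pathPairSum (pairKernel (n + 1) x) (n + 1) π ^ p)
      ≤ ((2 * p) ! : ℝ) * (36000 * Real.log (n + 2)) ^ p := by
  have hlog : 0 ≤ Real.log (n + 2) := Real.log_nonneg (by linarith [n.cast_nonneg (α := ℝ)])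
  have := pathMean_pair_moment_le (stepVec 5) n (B := Set.univ) (by simp)
    (Q := pairKernel (n + 1) x) (h := fun a => 1800 * (smoothNorm (a - x) ^ 2)⁻¹)
    (K := 36000 * Real.log (n + 2)) (by positivity) (pairKernel_nonneg _ _) (pairKernel_comm _ _)
    (fun a => by have := smoothNorm_pos (a - x); positivity)
    (fun a w _ => pot_pairKernel_le _ _ _ _) (fun w _ => by
      have e : (fun a => 1800 * (smoothNorm (a - x) ^ 2)⁻¹)
        = (1800 : ℝ) • fun a => (smoothNorm (a - x) ^ 2)⁻¹ := rfl
      rw [e, map_smul, Pi.smul_apply, smul_eq_mul]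
      have := pot_inv_sq_le_log (n + 1) x w
      rw [show (1 : ℝ) + ((n + 1 : ℕ) : ℝ) = n + 2 by push_cast; ring] at this
      linarith) p 0
  simpa using this

/-- The squared field at `y` created by the points of a path up to time `n`. -/
noncomputable def fieldSq (n : ℕ) (π : ℕ → Fin 5 → ℤ) (y : Fin 5 → ℤ) : ℝ :=
  (∑ k ∈ Finset.range (n + 1), invCube (y - π k)) ^ 2

theorem fieldSq_nonneg (n : ℕ) (π : ℕ → Fin 5 → ℤ) (y : Fin 5 → ℤ) : 0 ≤ fieldSq n π y :=
  sq_nonneg _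

theorem pot_fieldSq (N n : ℕ) (π : ℕ → Fin 5 → ℤ) (x : Fin 5 → ℤ) :
    pot (stepVec 5) N (fieldSq n π) x = pathPairSum (pairKernel N x) (n + 1) π := by
  have : fieldSq n π = ∑ k ∈ Finset.range (n + 1), ∑ l ∈ Finset.range (n + 1),
      fun y => invCube (y - π k) * invCube (y - π l) := by
    funext y
    simp [fieldSq, sq, Finset.sum_mul_sum]
  rw [this]
  simp only [map_sum, Finset.sum_apply, pathPairSum, pairKernel]

/-- Splits at the threshold `l`: an m-th moment of a maximum is reduced to a p-th moment, which can
be summed over the points. -/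
theorem pow_le_pow_mul_one_add {K l : ℝ} (hK : 0 ≤ K) (hl : 0 < l) {m p : ℕ} (hmp : m ≤ p) :
    K ^ m ≤ l ^ m * (1 + (l ^ p)⁻¹ * K ^ p) := by
  rcases le_total K l with h | h
  · have h1 : K ^ m ≤ l ^ m := pow_le_pow_left₀ hK h m
    have h2 : 0 ≤ l ^ m * ((l ^ p)⁻¹ * K ^ p) := by positivity
    linarith
  · have h1 : (K / l) ^ m ≤ (K / l) ^ p := pow_le_pow_right₀ ((one_le_div hl).2 h) hmp
    rw [div_pow, div_pow, div_le_iff₀ (by positivity)] at h1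
    have : 0 ≤ l ^ m := by positivity
    rw [div_eq_mul_inv] at h1
    linarith

theorem pathMean_fieldSq_pow_le (n m p : ℕ) (hmp : m ≤ p) {l : ℝ} (hl : 0 < l)
    (hlp : ((2 * n + 1 : ℕ) : ℝ) ^ 5 * (((2 * p) ! : ℝ) * (36000 * Real.log (n + 2)) ^ p)
      ≤ l ^ p) :
    pathMean (stepVec 5) n (fun π => pathMean (stepVec 5) n
      (fun σ => pathSum (fieldSq n π) (n + 1) σ ^ m)) ≤ 2 * (m ! : ℝ) * l ^ m := by
  have hne : (cube 5 n).Nonempty := by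
    rw [← Finset.card_pos, card_cube]
    positivity
  set F : (Fin 5 → ℤ) → (ℕ → Fin 5 → ℤ) → ℝ :=
    fun x π => pathPairSum (pairKernel (n + 1) x) (n + 1) π with hF
  have hF0 : ∀ x π, 0 ≤ F x π := fun x π => pathPairSum_nonneg (pairKernel_nonneg _ _) _ _
  have hinner : ∀ π, pathMean (stepVec 5) n (fun σ => pathSum (fieldSq n π) (n + 1) σ ^ m)
      ≤ (m ! : ℝ) * l ^ m * (1 + (l ^ p)⁻¹ * ∑ x ∈ cube 5 n, F x π ^ p) := by
    intro π
    obtain ⟨z, hz, hmax⟩ := (cube 5 n).exists_max_image (fun x => F x π) hne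
    -- With zero pair kernel this is the ordinary Khas'minskii bound; the constant is the maximum of
    -- the potential over the cube.
    have h1 := pathMean_pair_moment_le (stepVec 5) n (B := (cube 5 n : Set (Fin 5 → ℤ)))
      (fun s j hj => walkPath_mem_cube s hj) (Q := fun _ _ => 0) (h := fieldSq n π) (K := F z π)
      (hF0 z π) (by simp) (by simp) (fieldSq_nonneg n π)
      (fun a w _ => by
        have : (fun _ => 0 : (Fin 5 → ℤ) → ℝ) = 0 := rfl
        rw [this, map_zero]
        exact fieldSq_nonneg n π a)
      (fun w hw => by rw [pot_fieldSq]; exact hmax w hw) 0 m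
    simp only [pow_zero, one_mul, mul_zero, zero_add] at h1
    have h2 := pow_le_pow_mul_one_add (hF0 z π) hl hmp
    have h3 : F z π ^ p ≤ ∑ x ∈ cube 5 n, F x π ^ p :=
      Finset.single_le_sum (f := fun x => F x π ^ p) (fun x _ => pow_nonneg (hF0 x π) p) hz
    calc _ ≤ (m ! : ℝ) * F z π ^ m := h1
      _ ≤ (m ! : ℝ) * (l ^ m * (1 + (l ^ p)⁻¹ * F z π ^ p)) := by gcongr
      _ ≤ (m ! : ℝ) * (l ^ m * (1 + (l ^ p)⁻¹ * ∑ x ∈ cube 5 n, F x π ^ p)) := by gcongr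
      _ = _ := by ring
  refine (pathMean_mono _ n hinner).trans ?_
  rw [pathMean_const_mul, pathMean_add, pathMean_const, pathMean_const_mul, pathMean_sum]
  have hsum : ∑ x ∈ cube 5 n, pathMean (stepVec 5) n (fun π => F x π ^ p) ≤ l ^ p := by
    refine (Finset.sum_le_sum fun x _ => pathMean_pairKernel_pow_le n p x).trans ?_
    rw [Finset.sum_const, card_cube, nsmul_eq_mul]
    push_cast at hlp ⊢
    exact hlp
  have hfin : (l ^ p)⁻¹ * ∑ x ∈ cube 5 n, pathMean (stepVec 5) n (fun π => F x π ^ p) ≤ 1 := by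
    rw [inv_mul_le_iff₀ (by positivity)]
    simpa using hsum
  calc _ ≤ (m ! : ℝ) * l ^ m * (1 + 1) := by gcongr
    _ = _ := by ring

theorem half_le_log {n : ℕ} (hn : 2 ≤ n) : 1 / 2 ≤ Real.log n := by
  have h1 := Real.log_two_gt_d9
  have h2 : Real.log 2 ≤ Real.log n := Real.log_le_log (by norm_num) (by exact_mod_cast hn)
  linarith

theorem log_add_two_le {n : ℕ} (hn : 2 ≤ n) : Real.log (n + 2) ≤ 2 * Real.log n := by
  have hn' : (2 : ℝ) ≤ n := by exact_mod_cast hn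
  have : 2 * Real.log n = Real.log ((n : ℝ) ^ 2) := by
    rw [Real.log_pow]
    norm_num
  rw [this]
  exact Real.log_le_log (by linarith) (by nlinarith)

/-- The moment bound for the smoothed interaction of two walks. -/
theorem pathMean_fieldSq_pow_le_log {n m : ℕ} (hn : 2 ≤ n) (hm : 1 ≤ m) :
    pathMean (stepVec 5) n (fun π => pathMean (stepVec 5) n
      (fun σ => pathSum (fieldSq n π) (n + 1) σ ^ m))
      ≤ (2 * (Real.exp 15 * 2592000 * Real.exp 2)) ^ m * (m ! : ℝ) ^ 3
        * Real.log n ^ (3 * m) := by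
  set L := Real.log n with hL
  have hL2 : 1 / 2 ≤ L := half_le_log hn
  have hn' : (2 : ℝ) ≤ n := by exact_mod_cast hn
  -- This gives m ≤ p, L ≤ p and p ≤ 3mL, the last because L ≥ 1/2. From L ≤ p, (2n+1)^5 ≤ n^15 ≤
  -- e^{15p}, whence the factor `exp 15` in `l`.
  set p := m * ⌈L⌉₊ with hp
  have hceil : 1 ≤ ⌈L⌉₊ := Nat.one_le_ceil_iff.2 (by linarith)
  have hmp : m ≤ p := Nat.le_mul_of_pos_right m hceil
  have hm' : (1 : ℝ) ≤ m := by exact_mod_cast hm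
  have hpL : L ≤ p := by
    have h1 := Nat.le_ceil L
    rw [hp]
    push_cast
    nlinarith [(⌈L⌉₊).cast_nonneg (α := ℝ)]
  have hpu : (p : ℝ) ≤ 3 * m * L := by
    have h1 := Nat.ceil_lt_add_one (show 0 ≤ L by linarith)
    rw [hp]
    push_cast
    nlinarith
  have hp0 : (0 : ℝ) < p := by linarith
  have hlog2 : 0 < Real.log (n + 2) := Real.log_pos (by linarith)
  set l := Real.exp 15 * (4 * (p : ℝ) ^ 2) * (36000 * Real.log (n + 2)) with hl
  have hl0 : 0 < l := by positivity
  have hlp : ((2 * n + 1 : ℕ) : ℝ) ^ 5 * (((2 * p) ! : ℝ) * (36000 * Real.log (n + 2)) ^ p)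
      ≤ l ^ p := by
    have h1 : ((2 * n + 1 : ℕ) : ℝ) ^ 5 ≤ Real.exp 15 ^ p := by
      have a1 : ((2 * n + 1 : ℕ) : ℝ) ≤ (n : ℝ) ^ 3 := by
        push_cast
        nlinarith [mul_nonneg (show (0 : ℝ) ≤ n by linarith) (show (0 : ℝ) ≤ n - 2 by linarith)]
      have a2 : (n : ℝ) ≤ Real.exp p := by
        rw [← Real.log_le_iff_le_exp (by linarith)]
        exact hpL
      calc ((2 * n + 1 : ℕ) : ℝ) ^ 5 ≤ ((n : ℝ) ^ 3) ^ 5 := by gcongr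
        _ ≤ (Real.exp p ^ 3) ^ 5 := by gcongr
        _ = Real.exp 15 ^ p := by
          rw [← pow_mul, ← Real.exp_nat_mul, ← Real.exp_nat_mul]
          congr 1
          push_cast
          ring
    have h2 : ((2 * p) ! : ℝ) ≤ (4 * (p : ℝ) ^ 2) ^ p := by
      have : ((2 * p) ! : ℝ) ≤ ((2 * p : ℕ) : ℝ) ^ (2 * p) := by
        exact_mod_cast Nat.factorial_le_pow (2 * p)
      refine this.trans_eq ?_
      rw [pow_mul]
      push_cast
      ring
    rw [hl, mul_pow (Real.exp 15 * _), mul_pow (Real.exp 15), mul_assoc]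
    gcongr
  have hmain := pathMean_fieldSq_pow_le n m p hmp hl0 hlp
  refine hmain.trans ?_
  -- The constant is 4 · 3² · 36000 · 2.
  have hlu : l ≤ Real.exp 15 * 2592000 * L ^ 3 * (m : ℝ) ^ 2 := by
    have a1 : (p : ℝ) ^ 2 ≤ (3 * m * L) ^ 2 := by gcongr
    have a2 := log_add_two_le hn
    calc l ≤ Real.exp 15 * (4 * (3 * m * L) ^ 2) * (36000 * (2 * L)) := by
          rw [hl]
          gcongr
      _ = _ := by ring
  have hmm : (m : ℝ) ^ m ≤ Real.exp 1 ^ m * (m ! : ℝ) := by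
    have := Real.pow_div_factorial_le_exp (m : ℝ) (by linarith) m
    rw [div_le_iff₀ (by positivity)] at this
    rwa [← Real.exp_nat_mul, mul_one]
  have h2m : (2 : ℝ) ≤ 2 ^ m := by
    simpa using pow_le_pow_right₀ (show (1 : ℝ) ≤ 2 by norm_num) hm
  have hL0 : 0 ≤ L := by linarith
  calc 2 * (m ! : ℝ) * l ^ m
      ≤ 2 ^ m * (m ! : ℝ) * (Real.exp 15 * 2592000 * L ^ 3 * (m : ℝ) ^ 2) ^ m := by gcongr
    _ = 2 ^ m * (m ! : ℝ) * (Real.exp 15 * 2592000) ^ m * L ^ (3 * m) * ((m : ℝ) ^ m) ^ 2 := by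
      rw [pow_mul]
      ring
    _ ≤ 2 ^ m * (m ! : ℝ) * (Real.exp 15 * 2592000) ^ m * L ^ (3 * m)
        * (Real.exp 1 ^ m * (m ! : ℝ)) ^ 2 := by gcongr
    _ = _ := by
      rw [show Real.exp 2 = Real.exp 1 ^ 2 by rw [← Real.exp_nat_mul]; norm_num,
        mul_pow 2 (Real.exp 15 * _ * _)]
      ring

/-! ### Reduction of the expectation to a mean over step sequences -/

theorem range_stepVec (d : ℕ) : Set.range (stepVec d) = unitSteps d := by
  ext x
  constructor
  · rintro ⟨⟨k, b⟩, rfl⟩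
    cases b
    · exact ⟨k, Or.inr (by simp [stepVec])⟩
    · exact ⟨k, Or.inl (by simp [stepVec])⟩
  · rintro ⟨k, rfl | rfl⟩
    · exact ⟨(k, true), by simp [stepVec]⟩
    · exact ⟨(k, false), by simp [stepVec]⟩

theorem stepVec_injective (d : ℕ) : Function.Injective (stepVec d) := by
  rintro ⟨k, b⟩ ⟨l, c⟩ h
  have hk := congrFun h k
  have hkl : k = l := by
    by_contra hne
    cases b <;> cases c <;> simp [stepVec, hne] at hk
  subst hkl
  cases b <;> cases c <;> simp [stepVec] at hk ⊢

theorem uniformOn_unitSteps_singleton (d : ℕ) (s : Fin d × Bool) :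
    uniformOn (unitSteps d) {stepVec d s} = ((2 * d : ℕ) : ENNReal)⁻¹ := by
  classical
  have h : unitSteps d = (Finset.univ.image (stepVec d) : Finset (Fin d → ℤ)) := by
    rw [← range_stepVec]
    simp
  have hmem : stepVec d s ∈ unitSteps d := by
    rw [← range_stepVec]
    exact ⟨s, rfl⟩
  have hc : (Finset.univ.image (stepVec d)).card = 2 * d := by
    rw [Finset.card_image_of_injective _ (stepVec_injective d)]
    simp [mul_comm]
  rw [uniformOn, cond_apply (h ▸ Finset.measurableSet _), Set.inter_singleton_of_mem hmem,
    Measure.count_singleton, mul_one, h, Measure.count_apply_finset, hc]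

section Transfer

variable {Ω : Type*} [MeasurableSpace Ω] {P : Measure Ω} {d : ℕ} {S : ℕ → Ω → (Fin d → ℤ)}

namespace IsSimpleRandomWalk

theorem measure_steps_eq (hS : IsSimpleRandomWalk S P) {n : ℕ} (s : Fin n → Fin d × Bool) :
    P {ω | ∀ i : Fin n, S (i + 1) ω - S i ω = stepVec d (s i)}
      = (((2 * d : ℕ) : ENNReal)⁻¹) ^ n := by
  have h := (hS.indep.precomp Fin.val_injective).measure_inter_preimage_eq_mul
    (Finset.univ : Finset (Fin n)) (sets := fun i => {stepVec d (s i)})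
    (fun i _ => measurableSet_singleton _)
  have hset : {ω | ∀ i : Fin n, S (i + 1) ω - S i ω = stepVec d (s i)}
      = ⋂ i ∈ (Finset.univ : Finset (Fin n)),
        (fun ω => S (i.val + 1) ω - S i.val ω) ⁻¹' {stepVec d (s i)} := by
    ext ω
    simp
  rw [hset, h]
  have hone : ∀ i : Fin n, P ((fun ω => S (i.val + 1) ω - S i.val ω) ⁻¹' {stepVec d (s i)})
      = ((2 * d : ℕ) : ENNReal)⁻¹ := by
    intro i
    have hm : Measurable fun ω => S (i.val + 1) ω - S i.val ω :=
      (hS.measurable _).sub (hS.measurable _)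
    rw [← Measure.map_apply hm (measurableSet_singleton _), hS.law, uniformOn_unitSteps_singleton]
  simp [hone]

theorem ae_step_mem (hS : IsSimpleRandomWalk S P) :
    ∀ᵐ ω ∂P, ∀ i, ∃ s, S (i + 1) ω - S i ω = stepVec d s := by
  rw [ae_all_iff]
  intro i
  have hm : Measurable fun ω => S (i + 1) ω - S i ω := (hS.measurable _).sub (hS.measurable _)
  have hfin : (unitSteps d).Finite := by
    rw [← range_stepVec]
    exact Set.finite_range _
  have h : P.map (fun ω => S (i + 1) ω - S i ω) (unitSteps d)ᶜ = 0 := by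
    rw [hS.law, uniformOn_eq_zero_iff hfin, Set.inter_compl_self]
  rw [Measure.map_apply hm hfin.measurableSet.compl] at h
  filter_upwards [measure_eq_zero_iff_ae_notMem.1 h] with ω hω
  have : S (i + 1) ω - S i ω ∈ unitSteps d := by simpa using hω
  rw [← range_stepVec] at this
  obtain ⟨s, hs⟩ := this
  exact ⟨s, hs.symm⟩

theorem ae_exists_walkPath (hS : IsSimpleRandomWalk S P) (n : ℕ) :
    ∀ᵐ ω ∂P, ∃ s : Fin n → Fin d × Bool,
      (∀ i : Fin n, S (i + 1) ω - S i ω = stepVec d (s i)) ∧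
      ∀ j ≤ n, S j ω = walkPath (stepVec d) s j := by
  filter_upwards [hS.ae_step_mem, hS.start] with ω hω h0
  choose s hs using hω
  refine ⟨fun i => s i, fun i => hs i, fun j hj => ?_⟩
  induction j with
  | zero => rw [h0, walkPath_zero]
  | succ j ih => rw [walkPath_succ _ _ hj, ← ih (by omega), ← hs j, add_sub_cancel]

/-- The expectation of a functional of the first `n` steps of two independent walks is a mean
over pairs of step sequences. -/
theorem integral_eq_pathMean [IsProbabilityMeasure P] {T : ℕ → Ω → (Fin d → ℤ)}
    (hS : IsSimpleRandomWalk S P) (hT : IsSimpleRandomWalk T P)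
    (hST : IndepFun (fun ω i => S i ω) (fun ω i => T i ω) P) (n : ℕ)
    (F : (ℕ → Fin d → ℤ) → (ℕ → Fin d → ℤ) → ℝ)
    (hF : ∀ σ σ' π π', (∀ j ≤ n, σ j = σ' j) → (∀ j ≤ n, π j = π' j) → F σ π = F σ' π') :
    ∫ ω, F (fun i => S i ω) (fun i => T i ω) ∂P
      = pathMean (stepVec d) n (fun π => pathMean (stepVec d) n fun σ => F σ π) := by
  set A : (ℕ → Ω → (Fin d → ℤ)) → (Fin n → Fin d × Bool) → Set Ω :=
    fun S s => {ω | ∀ i : Fin n, S (i + 1) ω - S i ω = stepVec d (s i)} with hA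
  set D : (Fin n → Fin d × Bool) → Set (ℕ → Fin d → ℤ) :=
    fun s => {π | ∀ i : Fin n, π (i + 1) - π i = stepVec d (s i)} with hD
  have hDm : ∀ s, MeasurableSet (D s) := by
    intro s
    have : D s = ⋂ i : Fin n,
        (fun π : ℕ → Fin d → ℤ => π (i + 1) - π i) ⁻¹' {stepVec d (s i)} := by
      ext π
      simp [hD]
    rw [this]
    refine MeasurableSet.iInter fun i => ?_
    have hm : Measurable fun π : ℕ → Fin d → ℤ => π (i + 1) - π i :=
      (measurable_pi_apply _).sub (measurable_pi_apply _)
    exact hm (measurableSet_singleton _)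
  have hmS : Measurable fun ω i => S i ω := measurable_pi_iff.2 hS.measurable
  have hmT : Measurable fun ω i => T i ω := measurable_pi_iff.2 hT.measurable
  have hAm : ∀ s t, MeasurableSet (A S s ∩ A T t) := fun s t =>
    (hmS (hDm s)).inter (hmT (hDm t))
  have hP : ∀ s t, P.real (A S s ∩ A T t)
      = ((Fintype.card (Fin d × Bool) : ℝ)⁻¹) ^ n * ((Fintype.card (Fin d × Bool) : ℝ)⁻¹) ^ n := by
    intro s t
    have h := hST.measure_inter_preimage_eq_mul (D s) (D t) (hDm s) (hDm t)
    have h' : P (A S s ∩ A T t) = P (A S s) * P (A T t) := h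
    rw [hS.measure_steps_eq, hT.measure_steps_eq] at h'
    rw [Measure.real, h']
    simp [mul_comm]
  -- Almost surely exactly one pair of step sequences occurs, so the functional is a finite sum of
  -- indicators.
  have hae : (fun ω => F (fun i => S i ω) (fun i => T i ω)) =ᵐ[P]
      fun ω => ∑ t : Fin n → Fin d × Bool, ∑ s : Fin n → Fin d × Bool,
        (A S s ∩ A T t).indicator
          (fun _ => F (walkPath (stepVec d) s) (walkPath (stepVec d) t)) ω := by
    have huniq : ∀ (S : ℕ → Ω → (Fin d → ℤ)) ω (s s' : Fin n → Fin d × Bool),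
        ω ∈ A S s → ω ∈ A S s' → s' = s := by
      intro S ω s s' h h'
      funext i
      exact stepVec_injective d ((h' i).symm.trans (h i))
    filter_upwards [hS.ae_exists_walkPath n, hT.ae_exists_walkPath n] with ω h1 h2
    obtain ⟨s, hs, hs'⟩ := h1
    obtain ⟨t, ht, ht'⟩ := h2
    have hmem : ω ∈ A S s ∩ A T t := ⟨hs, ht⟩
    rw [Finset.sum_eq_single t, Finset.sum_eq_single s, Set.indicator_of_mem hmem]
    · exact hF _ _ _ _ hs' ht'
    · intro s' _ hne
      exact Set.indicator_of_notMem (fun h => hne (huniq S ω s s' hs h.1)) _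
    · simp
    · intro t' _ hne
      refine Finset.sum_eq_zero fun s' _ => ?_
      exact Set.indicator_of_notMem (fun h => hne (huniq T ω t t' ht h.2)) _
    · simp
  have hint : ∀ s t, Integrable ((A S s ∩ A T t).indicator
      (fun _ => F (walkPath (stepVec d) s) (walkPath (stepVec d) t))) P := fun s t =>
    (integrable_const _).indicator (hAm s t)
  rw [integral_congr_ae hae,
    integral_finsetSum _ fun t _ => integrable_finsetSum _ fun s _ => hint s t]
  simp only [pathMean_apply, Finset.mul_sum]
  refine Finset.sum_congr rfl fun t _ => ?_
  rw [integral_finsetSum _ fun s _ => hint s t]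
  refine Finset.sum_congr rfl fun s _ => ?_
  rw [integral_indicator_const _ (hAm s t), hP, smul_eq_mul, mul_assoc]

end IsSimpleRandomWalk

end Transfer

/-! ### Expansion of the moments -/

theorem prod_fin_two_mul (m : ℕ) (f : Fin (2 * m) → ℝ) :
    ∏ l, f l = ∏ k : Fin m, f ⟨2 * k.val, by omega⟩ * f ⟨2 * k.val + 1, by omega⟩ := by
  induction m with
  | zero => simp
  | succ m ih =>
    have h : ∏ l : Fin (2 * m + 1 + 1), f l
        = (∏ l : Fin (2 * m), f l.castSucc.castSucc)
          * f (Fin.last (2 * m)).castSucc * f (Fin.last (2 * m + 1)) := by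
      rw [Fin.prod_univ_castSucc, Fin.prod_univ_castSucc]
    have h' := ih fun l => f l.castSucc.castSucc
    rw [h'] at h
    rw [Fin.prod_univ_castSucc, ← mul_assoc]
    exact h

theorem sum_sq_pow_eq (t : Finset ℕ) (a : ℕ → ℕ → ℝ) (m : ℕ) :
    (∑ i ∈ t, ∑ j₁ ∈ t, ∑ j₂ ∈ t, a i j₁ * a i j₂) ^ m
      = ∑ i ∈ Fintype.piFinset (fun _ : Fin m => t),
        ∑ j ∈ Fintype.piFinset (fun _ : Fin (2 * m) => t),
          ∏ k : Fin m, (a (i k) (j ⟨2 * k.val, by omega⟩) *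
            a (i k) (j ⟨2 * k.val + 1, by omega⟩)) := by
  have h1 := Finset.prod_univ_sum (fun _ : Fin m => t)
    (fun _ i => ∑ j₁ ∈ t, ∑ j₂ ∈ t, a i j₁ * a i j₂)
  rw [Finset.prod_const, Finset.card_univ, Fintype.card_fin] at h1
  rw [h1]
  refine Finset.sum_congr rfl fun i _ => ?_
  -- The 2m factors are indexed by l, and factor l uses the point `i (l / 2)`.
  have h2 := Finset.prod_univ_sum (fun _ : Fin (2 * m) => t)
    (fun l j => a (i ⟨l.val / 2, by omega⟩) j)
  rw [prod_fin_two_mul] at h2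
  have e1 : ∀ k : Fin m, (⟨2 * k.val / 2, by omega⟩ : Fin m) = k := fun k => by
    ext
    simp
  have e2 : ∀ k : Fin m, (⟨(2 * k.val + 1) / 2, by omega⟩ : Fin m) = k := fun k => by
    ext
    simp
    omega
  simp only [e1, e2] at h2
  simp only [← Finset.sum_mul_sum]
  rw [h2]
  refine Finset.sum_congr rfl fun j _ => ?_
  rw [prod_fin_two_mul]
  simp only [e1, e2]

theorem errorSum_pow_eq {Ω : Type*} {d : ℕ} (S T : ℕ → Ω → (Fin d → ℤ)) (n m : ℕ) (ω : Ω) :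
    errorSum S T n ω ^ m = errorMomentSum S T n m ω :=
  sum_sq_pow_eq (Finset.Icc 1 n) (fun i j => plusNorm (S i ω - T j ω) ^ (-3 : ℤ)) m

theorem one_le_plusNorm {d : ℕ} (x : Fin d → ℤ) : 1 ≤ plusNorm x := le_max_right _ _

theorem plusNorm_zpow_nonneg {d : ℕ} (x : Fin d → ℤ) : 0 ≤ plusNorm x ^ (-3 : ℤ) :=
  zpow_nonneg (zero_le_one.trans (one_le_plusNorm x)) _

theorem plusNorm_zpow_le_one {d : ℕ} (x : Fin d → ℤ) : plusNorm x ^ (-3 : ℤ) ≤ 1 :=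
  zpow_le_one_of_nonpos₀ (one_le_plusNorm x) (by norm_num)

theorem smoothNorm_le_plusNorm {d : ℕ} (x : Fin d → ℤ) : smoothNorm x ≤ 3 * plusNorm x := by
  have h1 := one_le_plusNorm x
  apply Real.sqrt_le_iff.2 ⟨by linarith, ?_⟩
  have h2 : √(sqNorm x) ≤ plusNorm x := by
    refine le_trans (le_of_eq ?_) (le_max_left _ _)
    rw [EuclideanSpace.norm_eq]
    simp [sqNorm]
  have h3 := Real.sq_sqrt (sqNorm_nonneg x)
  nlinarith [Real.sqrt_nonneg (sqNorm x)]

theorem plusNorm_zpow_le_invCube (x : Fin 5 → ℤ) : plusNorm x ^ (-3 : ℤ) ≤ 27 * invCube x := by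
  have h1 := one_le_plusNorm x
  have h2 := smoothNorm_le_plusNorm x
  have h3 := smoothNorm_pos x
  have h4 : smoothNorm x ^ 3 ≤ (3 * plusNorm x) ^ 3 := by gcongr
  rw [zpow_neg, invCube, ← div_eq_mul_inv, inv_eq_one_div]
  rw [div_le_div_iff₀ (by positivity) (by positivity)]
  have : plusNorm x ^ (3 : ℤ) = plusNorm x ^ 3 := by norm_cast
  rw [this]
  linarith

/-- The interaction of two paths up to time `n`. -/
noncomputable def pathError (n : ℕ) (σ π : ℕ → Fin 5 → ℤ) : ℝ :=
  ∑ i ∈ Finset.Icc 1 n, ∑ j₁ ∈ Finset.Icc 1 n, ∑ j₂ ∈ Finset.Icc 1 n,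
    plusNorm (σ i - π j₁) ^ (-3 : ℤ) * plusNorm (σ i - π j₂) ^ (-3 : ℤ)

theorem pathError_nonneg (n : ℕ) (σ π : ℕ → Fin 5 → ℤ) : 0 ≤ pathError n σ π :=
  Finset.sum_nonneg fun _ _ => Finset.sum_nonneg fun _ _ => Finset.sum_nonneg fun _ _ =>
    mul_nonneg (plusNorm_zpow_nonneg _) (plusNorm_zpow_nonneg _)

theorem pathError_le (n : ℕ) (σ π : ℕ → Fin 5 → ℤ) :
    pathError n σ π ≤ 729 * pathSum (fieldSq n π) (n + 1) σ := by
  have hsub : Finset.Icc 1 n ⊆ Finset.range (n + 1) := fun k hk => by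
    rw [Finset.mem_Icc] at hk
    rw [Finset.mem_range]
    omega
  rw [pathSum, Finset.mul_sum]
  refine le_trans (Finset.sum_le_sum fun i _ => ?_)
    (Finset.sum_le_sum_of_subset_of_nonneg hsub fun i _ _ =>
      mul_nonneg (by norm_num) (fieldSq_nonneg n π (σ i)))
  have h1 : ∑ j ∈ Finset.Icc 1 n, plusNorm (σ i - π j) ^ (-3 : ℤ)
      ≤ 27 * ∑ k ∈ Finset.range (n + 1), invCube (σ i - π k) := by
    rw [Finset.mul_sum]
    exact (Finset.sum_le_sum fun j _ => plusNorm_zpow_le_invCube _).trans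
      (Finset.sum_le_sum_of_subset_of_nonneg hsub fun j _ _ =>
        mul_nonneg (by norm_num) (invCube_nonneg _))
  have h0 : 0 ≤ ∑ j ∈ Finset.Icc 1 n, plusNorm (σ i - π j) ^ (-3 : ℤ) :=
    Finset.sum_nonneg fun j _ => plusNorm_zpow_nonneg _
  calc _ = (∑ j ∈ Finset.Icc 1 n, plusNorm (σ i - π j) ^ (-3 : ℤ)) ^ 2 := by
        rw [sq, Finset.sum_mul_sum]
    _ ≤ (27 * ∑ k ∈ Finset.range (n + 1), invCube (σ i - π k)) ^ 2 :=
        pow_le_pow_left₀ h0 h1 2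
    _ = _ := by
        rw [fieldSq]
        ring

theorem integrable_errorMomentSum {Ω : Type*} [MeasurableSpace Ω] {P : Measure Ω}
    [IsProbabilityMeasure P] {d : ℕ} {S T : ℕ → Ω → (Fin d → ℤ)} (hS : ∀ i, Measurable (S i))
    (hT : ∀ i, Measurable (T i)) (n m : ℕ) : Integrable (errorMomentSum S T n m) P := by
  have hm : ∀ i j, Measurable fun ω => plusNorm (S i ω - T j ω) ^ (-3 : ℤ) := fun i j =>
    (Measurable.of_discrete (f := fun x : Fin d → ℤ => plusNorm x ^ (-3 : ℤ))).comp
      ((hS i).sub (hT j))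
  refine integrable_finsetSum _ fun i _ => integrable_finsetSum _ fun j _ => ?_
  refine Integrable.of_bound (C := 1) (Finset.measurable_prod _ fun k _ =>
    (hm _ _).mul (hm _ _)).aestronglyMeasurable (Filter.Eventually.of_forall fun ω => ?_)
  rw [Real.norm_eq_abs, abs_of_nonneg (Finset.prod_nonneg fun k _ =>
    mul_nonneg (plusNorm_zpow_nonneg _) (plusNorm_zpow_nonneg _))]
  exact Finset.prod_le_one (fun k _ => mul_nonneg (plusNorm_zpow_nonneg _) (plusNorm_zpow_nonneg _))
    fun k _ => mul_le_one₀ (plusNorm_zpow_le_one _) (plusNorm_zpow_nonneg _) (plusNorm_zpow_le_one _)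

theorem proposition3p2 :
    ∃ C : ℝ, 0 < C ∧
      ∀ (Ω : Type*) [MeasurableSpace Ω] (P : Measure Ω) [IsProbabilityMeasure P]
        (S T : ℕ → Ω → (Fin 5 → ℤ)),
        IsSimpleRandomWalk S P → IsSimpleRandomWalk T P →
        IndepFun (fun ω i => S i ω) (fun ω i => T i ω) P →
        ∀ n m : ℕ, 2 ≤ n → 1 ≤ m →
          Integrable (errorMomentSum S T n m) P ∧
          ∫ ω, errorSum S T n ω ^ m ∂P = ∫ ω, errorMomentSum S T n m ω ∂P ∧
          ∫ ω, errorMomentSum S T n m ω ∂P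
            ≤ C ^ m * (m ! : ℝ) ^ 3 * Real.log n ^ (3 * m) := by
  -- 729 = 27² comes from replacing |·|_+ by the smoothed norm, at most three times larger, in two
  -- inverse cubes.
  refine ⟨729 * (2 * (Real.exp 15 * 2592000 * Real.exp 2)), by positivity, ?_⟩
  intro Ω _ P _ S T hS hT hST n m hn hm
  refine ⟨integrable_errorMomentSum hS.measurable hT.measurable n m,
    integral_congr_ae (Filter.Eventually.of_forall fun ω => errorSum_pow_eq S T n m ω), ?_⟩
  have h1 := hS.integral_eq_pathMean hT hST n (fun σ π => pathError n σ π ^ m) (by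
    intro σ σ' π π' hσ hπ
    have : pathError n σ π = pathError n σ' π' := by
      refine Finset.sum_congr rfl fun i hi => Finset.sum_congr rfl fun j hj =>
        Finset.sum_congr rfl fun k hk => ?_
      rw [hσ i (Finset.mem_Icc.1 hi).2, hπ j (Finset.mem_Icc.1 hj).2,
        hπ k (Finset.mem_Icc.1 hk).2]
    simp only [this])
  have h2 : ∀ ω, errorMomentSum S T n m ω = pathError n (fun i => S i ω) (fun i => T i ω) ^ m :=
    fun ω => (errorSum_pow_eq S T n m ω).symm
  simp only [h2]
  rw [h1]
  calc _ ≤ pathMean (stepVec 5) n (fun π => pathMean (stepVec 5) n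
        (fun σ => 729 ^ m * pathSum (fieldSq n π) (n + 1) σ ^ m)) := by
        refine pathMean_mono _ n fun π => pathMean_mono _ n fun σ => ?_
        rw [← mul_pow]
        exact pow_le_pow_left₀ (pathError_nonneg n σ π) (pathError_le n σ π) m
    _ = 729 ^ m * pathMean (stepVec 5) n (fun π => pathMean (stepVec 5) n
        (fun σ => pathSum (fieldSq n π) (n + 1) σ ^ m)) := by
        simp only [pathMean_const_mul]
    _ ≤ 729 ^ m * ((2 * (Real.exp 15 * 2592000 * Real.exp 2)) ^ m * (m ! : ℝ) ^ 3
        * Real.log n ^ (3 * m)) := by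
        gcongr
        exact pathMean_fieldSq_pow_le_log hn hm
    _ = _ := by
        rw [mul_pow 729]
        ring
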